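/- Let $M$ be a closed connected $(n+1)$-dimensional smooth Riemannian manifold whose sectional curvature satisfies $-4(1-\tau)\le\kappa\le-1$ for some constant $0<\tau<1$, and let $\tilde M$ be its Riemannian universal cover. Let $\xi\in\partial\tilde M$ be the endpoint $c(+\infty)$ of a complete unit speed geodesic $c$ of $\tilde M$. Write $B_\xi(x)=\lim_{t\to\infty}\big(d(x,c(t))-d(c(0),c(t))\big)$ for the Busemann function and $H_\xi(s)=\{B_\xi=-s\}$, $s\in\mathbb R$, for the horospheres centred at $\xi$; each is given the Riemannian metric induced from $\tilde M$. Let $\varphi_{t,\xi}:\tilde M\to\tilde M$ send $x$ to $\gamma(t)$, where $\gamma$ is the unit speed geodesic with $\gamma(0)=x$ and $\gamma(+\infty)=\xi$, so that $\varphi_{t,\xi}H_\xi(s)=H_\xi(s+t)$. Let $\rho>0$ be a lower bound for the injectivity radius of every horosphere of $\tilde M$, in the sense that any two points of a horosphere at induced distance less than $\rho$ are joined by a unique minimizing geodesic of the horosphere. For such $x,y\in H_\xi(s)$ let $P^\xi_s(x,y):T_xH_\xi(s)\to T_yH_\xi(s)$ be the parallel transport of the Levi-Civita connection of the induced metric along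 that geodesic. The stable holonomy is the family of linear maps $\Pi^\xi_s(x,y):T_xH_\xi(s)\to T_yH_\xi(s)$, $s\in\mathbb R$, $x,y\in H_\xi(s)$, such that 1. $\Pi^\xi_s(x,x)=\mathrm{Id}$ and $\Pi^\xi_s(x,y)=\Pi^\xi_s(z,y)\circ\Pi^\xi_s(x,z)$ for all $x,y,z\in H_\xi(s)$; 2. $D\varphi_{t,\xi}(y)\circ\Pi^\xi_s(x,y)=\Pi^\xi_{s+t}(\varphi_{t,\xi}(x),\varphi_{t,\xi}(y))\circ D\varphi_{t,\xi}(x)$ on $T_xH_\xi(s)$ for all $s,t\in\mathbb R$ and $x,y\in H_\xi(s)$; 3. there is a constant $C$ such that $\|\Pi^\xi_s(x,y)-P^\xi_s(x,y)\|\le C\,d_{H_\xi(s)}(x,y)$ for all $s$ and all $x,y\in H_\xi(s)$ with $d_{H_\xi(s)}(x,y)<\rho$. Let $H_\xi=H_\xi(s)$ be one of these horospheres and $x_0\in H_\xi$. Suppose that $\Pi^\xi_s(x,y)=P^\xi_s(x,y)$ for all $x,y$ in the open ball $B_{H_\xi}(x_0,\rho/2)$ of the induced distance. Then the induced metric of $H_\xi$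 is flat on $B_{H_\xi}(x_0,\rho/2)$, that is, its Riemann curvature tensor vanishes there. -/

import Mathlib

open Bundle
open scoped Manifold ContDiff Topology

noncomputable section

namespace Horo

/-- The coordinate space `ℝ^m`. -/
abbrev E (m : ℕ) : Type := EuclideanSpace ℝ (Fin m)

/-! ### A Riemannian metric in coordinates

`G u` is the Gram matrix `(g_ij(u))` of a metric on an open subset of `ℝ^m`. -/

section Coordinates

variable {m : ℕ}

/-- The `k`-th partial derivative. -/
def partialD (k : Fin m) (f : E m → ℝ) (u : E m) : ℝ :=
  fderiv ℝ f u (EuclideanSpace.single k 1)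

/-- The Christoffel symbol `Γ^k_ij` of the Levi-Civita connection:
`Γ^k_ij = ½ ∑_l g^kl (∂_i g_jl + ∂_j g_il - ∂_l g_ij)`. -/
def christoffel (G : E m → Matrix (Fin m) (Fin m) ℝ) (k i j : Fin m) (u : E m) : ℝ :=
  (1 / 2 : ℝ) * ∑ l, (G u)⁻¹ k l *
    (partialD i (fun v => G v j l) u + partialD j (fun v => G v i l) u
      - partialD l (fun v => G v i j) u)

/-- The vector `Γ_u(a, b) = (∑_ij Γ^k_ij(u) a^i b^j)_k`. -/
def christoffelVec (G : E m → Matrix (Fin m) (Fin m) ℝ) (u a b : E m) : E m :=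
  WithLp.toLp 2 fun k => ∑ i, ∑ j, christoffel G k i j u * a i * b j

/-- The components of the Riemann tensor, `R(∂_i, ∂_j) ∂_k = ∑_l R^l_ijk ∂_l`, with
`R(X, Y) Z = ∇_X ∇_Y Z - ∇_Y ∇_X Z - ∇_[X,Y] Z`. -/
def riemann (G : E m → Matrix (Fin m) (Fin m) ℝ) (l i j k : Fin m) (u : E m) : ℝ :=
  partialD i (christoffel G l j k) u - partialD j (christoffel G l i k) u
    + ∑ p, (christoffel G l i p u * christoffel G p j k u
      - christoffel G l j p u * christoffel G p i k u)

/-- The inner product `g_u(a, b)`. -/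
def gInner (G : E m → Matrix (Fin m) (Fin m) ℝ) (u a b : E m) : ℝ :=
  ∑ i, ∑ j, G u i j * a i * b j

/-- `g_u(R(a, b) b, a)`. -/
def curvNum (G : E m → Matrix (Fin m) (Fin m) ℝ) (u a b : E m) : ℝ :=
  ∑ l, ∑ q, ∑ i, ∑ j, ∑ k, G u l q * riemann G l i j k u * a i * b j * b k * a q

/-- The squared area of the parallelogram spanned by `a` and `b`. -/
def areaSq (G : E m → Matrix (Fin m) (Fin m) ℝ) (u a b : E m) : ℝ :=
  gInner G u a a * gInner G u b b - gInner G u a b ^ 2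

end Coordinates

/-! ### Intrinsic Riemannian geometry of an embedded submanifold

`N` is a Riemannian manifold of dimension `d`, and `S` is an embedded submanifold of `N` of
dimension `m`, with the induced metric. The case `S = univ`, `m = d` is that of `N` itself. -/

section Submanifold

variable (d : ℕ) {N : Type*} [TopologicalSpace N] [ChartedSpace (E d) N]

/-- `ψ : U → S` is a smooth local parametrization (the inverse of a chart) of the
`m`-dimensional submanifold `S` of `N`: `U` is open in `ℝ^m`, and `ψ` is a smooth immersion on `U`
and a homeomorphism of `U` onto a relatively open subset of `S`. -/
structure IsLocalParam {m : ℕ} (S : Set N) (ψ : E m → N) (U : Set (E m)) : Prop where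
  isOpen : IsOpen U
  smooth : ContMDiffOn (𝓡 m) (𝓡 d) ∞ ψ U
  immersion : ∀ u ∈ U, Function.Injective (mfderiv (𝓡 m) (𝓡 d) ψ u)
  embedding : Topology.IsEmbedding (U.domRestrict ψ)
  image : ∃ W : Set N, IsOpen W ∧ ψ '' U = S ∩ W

/-- The tangent space `T_x S`, as a subspace of `T_x N`: the velocities at `x` of smooth curves
in `S`. -/
def tangentSub (S : Set N) (x : N) : Submodule ℝ (TangentSpace (𝓡 d) x) :=
  Submodule.span ℝ {v | ∃ γ : ℝ → N, ContMDiffAt 𝓘(ℝ, ℝ) (𝓡 d) ∞ γ 0 ∧ (∀ᶠ t in 𝓝 0, γ t ∈ S) ∧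
    (⟨γ 0, mfderiv 𝓘(ℝ, ℝ) (𝓡 d) γ 0 (1 : ℝ)⟩ : TangentBundle (𝓡 d) N) = ⟨x, v⟩}

variable [IsManifold (𝓡 d) ∞ N] [RiemannianBundle (fun x : N => TangentSpace (𝓡 d) x)]

/-- The Gram matrix, in the coordinates given by `ψ`, of the metric induced by that of `N`. -/
def gram {m : ℕ} (ψ : E m → N) (u : E m) : Matrix (Fin m) (Fin m) ℝ :=
  fun i j => inner ℝ
    (mfderiv (𝓡 m) (𝓡 d) ψ u (EuclideanSpace.single i (1 : ℝ)))
    (mfderiv (𝓡 m) (𝓡 d) ψ u (EuclideanSpace.single j (1 : ℝ)))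

/-- The induced distance `d_S`: the infimum of the lengths of the `C^1` curves in `S`. -/
def inducedEDist (S : Set N) (x y : N) : ENNReal :=
  ⨅ γ ∈ {γ : ℝ → N | ContMDiffOn 𝓘(ℝ, ℝ) (𝓡 d) 1 γ (Set.Icc 0 1) ∧
    Set.MapsTo γ (Set.Icc 0 1) S ∧ γ 0 = x ∧ γ 1 = y}, Manifold.pathELength (𝓡 d) γ 0 1

/-- The open ball `B_S(x, r)` of the induced distance. -/
def inducedBall (S : Set N) (x : N) (r : ℝ) : Set N :=
  {y | y ∈ S ∧ inducedEDist d S x y < ENNReal.ofReal r}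

/-- `γ`, restricted to the time interval `J`, is a geodesic of the `m`-dimensional Riemannian
submanifold `S`: a smooth curve in `S` with `u'' + Γ_u(u', u') = 0` in all local coordinates
`u = ψ⁻¹ ∘ γ` of `S`. -/
def IsGeodesicOn (m : ℕ) (S : Set N) (J : Set ℝ) (γ : ℝ → N) : Prop :=
  ContMDiffOn 𝓘(ℝ, ℝ) (𝓡 d) ∞ γ J ∧ Set.MapsTo γ J S ∧
  ∀ (ψ : E m → N) (U : Set (E m)), IsLocalParam d S ψ U →
    ∀ t ∈ interior J, ∀ u : ℝ → E m, (∀ᶠ t' in 𝓝 t, u t' ∈ U ∧ ψ (u t') = γ t') →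
      HasDerivAt (deriv u) (-christoffelVec (gram d ψ) (u t) (deriv u t) (deriv u t)) t

/-- `V` is a parallel vector field along the curve `γ : J → S`, for the Levi-Civita connection of
the induced metric of the `m`-dimensional submanifold `S`: `V` is a `C^1` field along `γ`,
tangent to `S`, with `a' + Γ_u(u', a) = 0` in all local coordinates of `S`, where
`u = ψ⁻¹ ∘ γ` and `a` are the coordinates of `γ` and of `V`. -/
def IsParallelOn (m : ℕ) (S : Set N) (J : Set ℝ) (γ : ℝ → N)
    (V : ∀ t, TangentSpace (𝓡 d) (γ t)) : Prop :=
  ContMDiffOn 𝓘(ℝ, ℝ) (𝓡 d).tangent 1 (fun t => (⟨γ t, V t⟩ : TangentBundle (𝓡 d) N)) J ∧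
  (∀ t ∈ J, V t ∈ tangentSub d S (γ t)) ∧
  ∀ (ψ : E m → N) (U : Set (E m)), IsLocalParam d S ψ U →
    ∀ t ∈ interior J, ∀ u a : ℝ → E m,
      (∀ᶠ t' in 𝓝 t, u t' ∈ U ∧
        (⟨ψ (u t'), mfderiv (𝓡 m) (𝓡 d) ψ (u t') (a t')⟩ : TangentBundle (𝓡 d) N)
          = ⟨γ t', V t'⟩) →
      HasDerivAt a (-christoffelVec (gram d ψ) (u t) (deriv u t) (a t)) t

/-- `γ : [0,1] → S` is a minimizing geodesic of `S` from `x` to `y`. -/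
def IsMinGeodesic (m : ℕ) (S : Set N) (x y : N) (γ : ℝ → N) : Prop :=
  IsGeodesicOn d m S (Set.Icc 0 1) γ ∧ γ 0 = x ∧ γ 1 = y ∧
    Manifold.pathELength (𝓡 d) γ 0 1 = inducedEDist d S x y

/-- Any two points of `S` at induced distance less than `ρ` are joined by exactly one minimizing
geodesic of `S`. This is what a lower bound `ρ` for the injectivity radius of `S` provides. -/
def UniqueMinGeodesics (m : ℕ) (S : Set N) (ρ : ℝ) : Prop :=
  ∀ x ∈ S, ∀ y ∈ S, inducedEDist d S x y < ENNReal.ofReal ρ →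
    (∃ γ, IsMinGeodesic d m S x y γ) ∧
    ∀ γ γ', IsMinGeodesic d m S x y γ → IsMinGeodesic d m S x y γ' → Set.EqOn γ γ' (Set.Icc 0 1)

/-- The graph of the parallel transport `P(x,y) : T_x S → T_y S` along the minimizing geodesic of
`S` from `x` to `y`, for the Levi-Civita connection of the induced metric: `P(x,y) X = Y`. -/
def ParallelTransport (m : ℕ) (S : Set N) (x y : N)
    (X : TangentSpace (𝓡 d) x) (Y : TangentSpace (𝓡 d) y) : Prop :=
  ∃ (γ : ℝ → N) (V : ∀ t, TangentSpace (𝓡 d) (γ t)),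
    IsMinGeodesic d m S x y γ ∧ IsParallelOn d m S (Set.Icc 0 1) γ V ∧
    (⟨γ 0, V 0⟩ : TangentBundle (𝓡 d) N) = ⟨x, X⟩ ∧
    (⟨γ 1, V 1⟩ : TangentBundle (𝓡 d) N) = ⟨y, Y⟩

/-- The induced metric of the `m`-dimensional submanifold `S` is flat on `B ⊆ S`: its Riemann
curvature tensor vanishes at every point of `B`. -/
def IsFlatOn (m : ℕ) (S B : Set N) : Prop :=
  ∀ (ψ : E m → N) (U : Set (E m)), IsLocalParam d S ψ U → ∀ u ∈ U, ψ u ∈ B →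
    ∀ l i j k, riemann (gram d ψ) l i j k u = 0

/-- The sectional curvature `κ` of the `d`-dimensional Riemannian manifold `N` satisfies
`a ≤ κ ≤ b`, where `κ(v, w) = g(R(v, w) w, v) / (|v|² |w|² - g(v, w)²)`. -/
def SectionalCurvatureBetween (N : Type*) [TopologicalSpace N] [ChartedSpace (E d) N]
    [IsManifold (𝓡 d) ∞ N] [RiemannianBundle (fun x : N => TangentSpace (𝓡 d) x)]
    (a b : ℝ) : Prop :=
  ∀ (ψ : E d → N) (U : Set (E d)), IsLocalParam d Set.univ ψ U → ∀ u ∈ U, ∀ v w : E d,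
    a * areaSq (gram d ψ) u v w ≤ curvNum (gram d ψ) u v w ∧
    curvNum (gram d ψ) u v w ≤ b * areaSq (gram d ψ) u v w

end Submanifold

/-! ### The universal cover -/

/-- `p : N → M` is the Riemannian universal covering of `M`. -/
structure IsRiemannianUniversalCover (d : ℕ) {M N : Type*}
    [TopologicalSpace M] [ChartedSpace (E d) M] [IsManifold (𝓡 d) ∞ M]
    [RiemannianBundle (fun x : M => TangentSpace (𝓡 d) x)]
    [TopologicalSpace N] [ChartedSpace (E d) N] [IsManifold (𝓡 d) ∞ N]
    [RiemannianBundle (fun x : N => TangentSpace (𝓡 d) x)] (p : N → M) : Prop where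
  simplyConnected : SimplyConnectedSpace N
  covering : IsCoveringMap p
  localDiffeo : IsLocalDiffeomorph (𝓡 d) (𝓡 d) ∞ p
  isometric : ∀ (x : N) (v : TangentSpace (𝓡 d) x), ‖mfderiv (𝓡 d) (𝓡 d) p x v‖ = ‖v‖

/-! ### Horospheres and stable holonomy

In this section `N` is the universal cover. A unit speed geodesic `c` stands for the boundary point
`ξ = c(+∞)`, and `c(0)` is the base point at which the Busemann function vanishes. -/

section Horospheres

variable (d : ℕ) {N : Type*} [MetricSpace N] [ChartedSpace (E d) N] [IsManifold (𝓡 d) ∞ N]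
  [RiemannianBundle (fun x : N => TangentSpace (𝓡 d) x)]

/-- A complete unit speed geodesic `c : ℝ → N`. -/
def IsUnitSpeedGeodesic (c : ℝ → N) : Prop :=
  IsGeodesicOn d d (Set.univ : Set N) Set.univ c ∧
    ∀ t, ‖mfderiv 𝓘(ℝ, ℝ) (𝓡 d) c t (1 : ℝ)‖ = 1

/-- The rays `c|[0,∞)` and `c'|[0,∞)` are at finite Hausdorff distance, i.e. they define the
same boundary point `c(+∞) = c'(+∞)`. -/
def Asymptotic (c c' : ℝ → N) : Prop :=
  Metric.hausdorffEDist (c '' Set.Ici 0) (c' '' Set.Ici 0) ≠ ⊤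

/-- The Busemann function `B_ξ(x) = lim_{t → ∞} (d(x, c(t)) - d(c(0), c(t)))`, `ξ = c(+∞)`. -/
def busemann (c : ℝ → N) (x : N) : ℝ :=
  Filter.limUnder Filter.atTop fun t : ℝ => dist x (c t) - dist (c 0) (c t)

/-- The horosphere `H_ξ(s)` centred at `ξ = c(+∞)` that the geodesic `c` meets at time `s`. As
`B_ξ(c(s)) = -s`, it is the level set `{B_ξ = -s}`. -/
def horosphere (c : ℝ → N) (s : ℝ) : Set N :=
  {x | busemann c x = -s}

open Classical in
/-- The flow `φ_{t,ξ}`, `ξ = c(+∞)`, on the universal cover: `φ_{t,ξ}(x) = γ(t)` for the unique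
unit speed geodesic `γ` with `γ(0) = x` and `γ(+∞) = ξ`. -/
def stableFlow (c : ℝ → N) (t : ℝ) (x : N) : N :=
  if h : ∃ γ : ℝ → N, IsUnitSpeedGeodesic d γ ∧ γ 0 = x ∧ Asymptotic γ c then h.choose t else x

/-- `Φ` is the stable holonomy along the horospheres `H_ξ(s)`, `s ∈ ℝ`, centred at `ξ = c(+∞)`,
each of dimension `m`: a family of linear maps `Φ_s(x,y) : T_x H_ξ(s) → T_y H_ξ(s)`, for
`x, y ∈ H_ξ(s)`, that is a cocycle, is invariant under the flow `φ_{t,ξ}`, and satisfies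
`‖Φ_s(x,y) - P_s(x,y)‖ ≤ C d(x,y)` whenever `d(x,y) < ρ`, where `P_s(x,y)` is the Levi-Civita
parallel transport of `H_ξ(s)` along the minimizing geodesic from `x` to `y` and `d` is the
distance of `H_ξ(s)`. (Only the restriction of the linear map `Φ s x y` to `T_x H_ξ(s)`, for
`x, y ∈ H_ξ(s)`, matters.) -/
structure IsStableHolonomy (m : ℕ) (c : ℝ → N) (ρ : ℝ)
    (Φ : ℝ → ∀ x y : N, TangentSpace (𝓡 d) x →ₗ[ℝ] TangentSpace (𝓡 d) y) : Prop where
  mapsTo : ∀ s, ∀ x ∈ horosphere c s, ∀ y ∈ horosphere c s,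
    ∀ X ∈ tangentSub d (horosphere c s) x, Φ s x y X ∈ tangentSub d (horosphere c s) y
  refl : ∀ s, ∀ x ∈ horosphere c s, ∀ X ∈ tangentSub d (horosphere c s) x, Φ s x x X = X
  comp : ∀ s, ∀ x ∈ horosphere c s, ∀ y ∈ horosphere c s, ∀ z ∈ horosphere c s,
    ∀ X ∈ tangentSub d (horosphere c s) x, Φ s x y X = Φ s z y (Φ s x z X)
  invariant : ∀ s t, ∀ x ∈ horosphere c s, ∀ y ∈ horosphere c s,
    ∀ X ∈ tangentSub d (horosphere c s) x,
      mfderiv (𝓡 d) (𝓡 d) (stableFlow d c t) y (Φ s x y X) =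
        Φ (s + t) (stableFlow d c t x) (stableFlow d c t y)
          (mfderiv (𝓡 d) (𝓡 d) (stableFlow d c t) x X)
  close : ∃ C : ℝ, ∀ s, ∀ x ∈ horosphere c s, ∀ y ∈ horosphere c s,
    inducedEDist d (horosphere c s) x y < ENNReal.ofReal ρ →
    ∀ X ∈ tangentSub d (horosphere c s) x, ∀ Y : TangentSpace (𝓡 d) y,
      ParallelTransport d m (horosphere c s) x y X Y →
      ‖Φ s x y X - Y‖ ≤ C * (inducedEDist d (horosphere c s) x y).toReal * ‖X‖

end Horospheres

end Horo

end

/-!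
On the ball in question the parallel transport `P(x, y)` along minimizing geodesics coincides with
a cocycle, so it does not depend on intermediate points: transporting a tangent vector `X` from a
fixed point `p` to all nearby points `y` gives a vector field `A(y) = P(p, y) X` with
`A(y') = P(y, y') A(y)` for all nearby `y` and `y'`. Such a field is parallel, and a metric that has
a parallel field through every vector at `p` has vanishing curvature at `p`.

The work is in proving that `A` is parallel without knowing in advance that it is differentiable.
In the coordinates given by a local parametrization `ψ` of the horosphere, parallel transport from
`ψ w` to `ψ w'` is `id - Γ_w(w' - w, ·) + O(|w' - w|²)`, uniformly in `w` and `w'` near a given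
point (`IsLocalRetraction.exists_norm_parallelTransport_le`). Indeed, the minimizing geodesic has
length `O(|w' - w|)`, by comparison with a coordinate segment; hence it stays in the coordinate
patch, and the equation `a' = -Γ_u(u', a)` can be integrated with a quadratic error in the
coordinate length of `u` (`norm_transport_le`). The expansion shows at once that `A` is
differentiable, with `dA = -Γ(·, A)` (`hasFDerivAt_of_norm_sub_le_sq`), and the symmetry of the
second derivative of `A` says that the curvature annihilates `A` (`curvature_apply_eq_zero`).

Coordinates on a subset `S` of the ambient manifold are handled through a `C^1` left inverse `q` of
`ψ`, defined on an open subset of the ambient manifold (`IsLocalRetraction`), which the inverse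
function theorem provides. The argument is local and holds for any
subset `S` (`isFlatOn_inducedBall_of_cocycle`).
-/

namespace Horo

/-! ### Calculus in a coordinate patch -/

section Analysis

variable {F : Type*} [NormedAddCommGroup F] [NormedSpace ℝ F]

/-- A mean value inequality on `[0, t]` that needs derivatives in the open interval only. -/
theorem norm_sub_le_sub_of_hasDerivAt_Ioo {f f' : ℝ → F} {l l' : ℝ → ℝ}
    (hf : ContinuousOn f (Set.Icc 0 1)) (hl : ContinuousOn l (Set.Icc 0 1))
    (hf' : ∀ t ∈ Set.Ioo (0 : ℝ) 1, HasDerivAt f (f' t) t)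
    (hl' : ∀ t ∈ Set.Ioo (0 : ℝ) 1, HasDerivAt l (l' t) t)
    (hle : ∀ t ∈ Set.Ioo (0 : ℝ) 1, ‖f' t‖ ≤ l' t) {t : ℝ} (ht : t ∈ Set.Icc (0 : ℝ) 1) :
    ‖f t - f 0‖ ≤ l t - l 0 := by
  rcases ht.1.eq_or_lt with rfl | h0
  · simp
  have key : ∀ a ∈ Set.Ioo 0 t, ‖f t - f a‖ ≤ l t - l a := by
    intro a ha
    have hsub : Set.Icc a t ⊆ Set.Icc 0 1 := Set.Icc_subset_Icc ha.1.le ht.2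
    have hIoo : ∀ x ∈ Set.Ico a t, x ∈ Set.Ioo (0 : ℝ) 1 := fun x hx =>
      ⟨ha.1.trans_le hx.1, hx.2.trans_le ht.2⟩
    refine image_norm_le_of_norm_deriv_right_le_deriv_boundary' (f := fun x => f x - f a)
      (f' := f') (B := fun x => l x - l a) (B' := l') (a := a) (b := t)
      ((hf.mono hsub).sub continuousOn_const) ?_ (by simp)
      ((hl.mono hsub).sub continuousOn_const) ?_ (fun x hx => hle x (hIoo x hx))
      ⟨ha.2.le, le_rfl⟩
    · exact fun x hx => ((hf' x (hIoo x hx)).sub_const _).hasDerivWithinAt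
    · exact fun x hx => ((hl' x (hIoo x hx)).sub_const _).hasDerivWithinAt
  have hsub : Set.Ioo 0 t ⊆ Set.Icc 0 1 := fun x hx => ⟨hx.1.le, hx.2.le.trans ht.2⟩
  have h0mem : (0 : ℝ) ∈ Set.Icc (0 : ℝ) 1 := ⟨le_rfl, zero_le_one⟩
  -- let `a` tend to `0`
  have hne : (𝓝[Set.Ioo 0 t] (0 : ℝ)).NeBot := by
    rw [← mem_closure_iff_nhdsWithin_neBot, closure_Ioo h0.ne]
    exact ⟨le_rfl, h0.le⟩
  have h1 : Filter.Tendsto (fun a => ‖f t - f a‖) (𝓝[Set.Ioo 0 t] 0) (𝓝 ‖f t - f 0‖) :=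
    (tendsto_const_nhds.sub ((hf 0 h0mem).mono hsub)).norm
  have h2 : Filter.Tendsto (fun a => l t - l a) (𝓝[Set.Ioo 0 t] 0) (𝓝 (l t - l 0)) :=
    tendsto_const_nhds.sub ((hl 0 h0mem).mono hsub)
  exact le_of_tendsto_of_tendsto h1 h2 (eventually_nhdsWithin_of_forall key)

/-- First order expansion of a solution `a` of `a' = -B_u(u', a)` along a short curve `u`: the
error is quadratic in the length of `u`. This is the quantitative form of parallel transport along
a short curve. -/
theorem norm_transport_le {B : F → F →L[ℝ] F →L[ℝ] F} {D : Set F} {K L : ℝ} {u v a : ℝ → F}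
    (hK : 0 ≤ K) (hB : ∀ x ∈ D, ‖B x‖ ≤ K) (hBL : ∀ x ∈ D, ∀ y ∈ D, ‖B x - B y‖ ≤ K * ‖x - y‖)
    (hv : Continuous v) (hu : ContinuousOn u (Set.Icc 0 1)) (ha : ContinuousOn a (Set.Icc 0 1))
    (hu' : ∀ t ∈ Set.Ioo (0 : ℝ) 1, HasDerivAt u (v t) t)
    (ha' : ∀ t ∈ Set.Ioo (0 : ℝ) 1, HasDerivAt a (-B (u t) (v t) (a t)) t)
    (huD : ∀ t ∈ Set.Icc (0 : ℝ) 1, u t ∈ D) (hL : ∫ t in (0 : ℝ)..1, ‖v t‖ ≤ L)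
    (hKL : K * L ≤ 1 / 2) :
    ‖a 1 - a 0 + B (u 0) (u 1 - u 0) (a 0)‖ ≤ 2 * (K + K ^ 2) * L ^ 2 * ‖a 0‖ := by
  set l : ℝ → ℝ := fun t => ∫ x in (0 : ℝ)..t, ‖v x‖ with hl_def
  have hl' : ∀ t, HasDerivAt l ‖v t‖ t := fun t =>
    intervalIntegral.integral_hasDerivAt_right (hv.norm.intervalIntegrable _ _)
      (hv.norm.stronglyMeasurableAtFilter _ _) hv.norm.continuousAt
  have hlc : ContinuousOn l (Set.Icc 0 1) := fun t _ => (hl' t).continuousAt.continuousWithinAt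
  have hl0 : l 0 = 0 := by simp [hl_def]
  have hlL : ∀ t ∈ Set.Icc (0 : ℝ) 1, l t ≤ L := by
    intro t ht
    refine le_trans ?_ hL
    exact intervalIntegral.integral_mono_interval le_rfl ht.1 ht.2
      (Filter.Eventually.of_forall fun _ => norm_nonneg _) (hv.norm.intervalIntegrable _ _)
  have h01 : (1 : ℝ) ∈ Set.Icc (0 : ℝ) 1 := ⟨zero_le_one, le_rfl⟩
  have h00 : (0 : ℝ) ∈ Set.Icc (0 : ℝ) 1 := ⟨le_rfl, zero_le_one⟩
  have hL0 : 0 ≤ L := hl0 ▸ hlL 0 h00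
  have hu0 : ∀ t ∈ Set.Icc (0 : ℝ) 1, ‖u t - u 0‖ ≤ L := by
    intro t ht
    have := norm_sub_le_sub_of_hasDerivAt_Ioo hu hlc hu' (fun t _ => hl' t) (fun t _ => le_rfl) ht
    have := hlL t ht
    linarith
  obtain ⟨t₀, ht₀, hmax⟩ := isCompact_Icc.exists_isMaxOn ⟨0, h00⟩ ha.norm
  set M : ℝ := ‖a t₀‖
  have hM : ∀ t ∈ Set.Icc (0 : ℝ) 1, ‖a t‖ ≤ M := fun t ht => hmax ht
  have hM0 : 0 ≤ M := norm_nonneg _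
  have hIoo : ∀ t ∈ Set.Ioo (0 : ℝ) 1, t ∈ Set.Icc (0 : ℝ) 1 := fun t ht => ⟨ht.1.le, ht.2.le⟩
  have hbil : ∀ (T : F →L[ℝ] F →L[ℝ] F) (p q : F) (c d : ℝ), ‖T‖ ≤ c → ‖q‖ ≤ d → 0 ≤ d →
      ‖T p q‖ ≤ c * d * ‖p‖ := by
    intro T p q c d hT hq hd
    have hc : 0 ≤ c := (norm_nonneg T).trans hT
    calc ‖T p q‖ ≤ ‖T‖ * ‖p‖ * ‖q‖ := T.le_opNorm₂ p q
      _ ≤ c * ‖p‖ * d := by gcongr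
      _ = c * d * ‖p‖ := by ring
  have haM : ∀ t ∈ Set.Icc (0 : ℝ) 1, ‖a t - a 0‖ ≤ K * M * L := by
    intro t ht
    have h := norm_sub_le_sub_of_hasDerivAt_Ioo ha (hlc.const_mul (K * M)) ha'
      (fun t _ => (hl' t).const_mul (K * M)) (fun t ht => by
        rw [norm_neg]
        exact hbil _ _ _ _ _ (hB _ (huD t (hIoo t ht))) (hM t (hIoo t ht)) hM0) ht
    rw [hl0, mul_zero, sub_zero] at h
    exact h.trans (mul_le_mul_of_nonneg_left (hlL t ht) (mul_nonneg hK hM0))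
  -- `‖a‖` at most doubles, since `‖a t - a 0‖ ≤ K * L * M ≤ M / 2` at the point of maximum
  have hM2 : M ≤ 2 * ‖a 0‖ := by
    have h1 := haM t₀ ht₀
    have h2 : M ≤ ‖a t₀ - a 0‖ + ‖a 0‖ := by
      simpa using norm_add_le (a t₀ - a 0) (a 0)
    have h3 : K * M * L ≤ 1 / 2 * M := by
      calc K * M * L = K * L * M := by ring
        _ ≤ 1 / 2 * M := by gcongr
    linarith
  -- compare with the solution of the frozen equation `g' = -B_{u 0}(u', a 0)`
  have hg := norm_sub_le_sub_of_hasDerivAt_Ioo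
    (f := fun t => a t + B (u 0) (u t) (a 0)) (l := fun t => (K + K ^ 2) * M * L * l t)
    (f' := fun t => -B (u t) (v t) (a t) + B (u 0) (v t) (a 0))
    (l' := fun t => (K + K ^ 2) * M * L * ‖v t‖)
    (ha.add ((((B (u 0)).flip (a 0)).continuous.comp_continuousOn hu)))
    (hlc.const_mul _)
    (fun t ht => (ha' t ht).add
      (((B (u 0)).flip (a 0)).hasFDerivAt.comp_hasDerivAt t (hu' t ht)))
    (fun t _ => (hl' t).const_mul _)
    (fun t ht => by
      have ht' := hIoo t ht
      have e : -B (u t) (v t) (a t) + B (u 0) (v t) (a 0)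
          = -((B (u t) - B (u 0)) (v t) (a t)) - B (u 0) (v t) (a t - a 0) := by
        simp only [sub_apply, map_sub]
        abel
      rw [e]
      have h1 := hbil (B (u t) - B (u 0)) (v t) (a t) (K * L) M
        ((hBL _ (huD t ht') _ (huD 0 h00)).trans
          (mul_le_mul_of_nonneg_left (hu0 t ht') hK)) (hM t ht') hM0
      have h2 := hbil (B (u 0)) (v t) (a t - a 0) K (K * M * L) (hB _ (huD 0 h00)) (haM t ht')
        (by positivity)
      calc _ ≤ ‖-((B (u t) - B (u 0)) (v t) (a t))‖ + ‖B (u 0) (v t) (a t - a 0)‖ :=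
            norm_sub_le _ _
        _ ≤ K * L * M * ‖v t‖ + K * (K * M * L) * ‖v t‖ := by
            rw [norm_neg]; exact add_le_add h1 h2
        _ = (K + K ^ 2) * M * L * ‖v t‖ := by ring)
    h01
  have e : a 1 - a 0 + B (u 0) (u 1 - u 0) (a 0)
      = (a 1 + B (u 0) (u 1) (a 0)) - (a 0 + B (u 0) (u 0) (a 0)) := by
    simp only [sub_apply, map_sub]
    abel
  rw [e]
  refine hg.trans ?_
  simp only [hl0, mul_zero, sub_zero]
  have := hlL 1 h01
  have hl1 : 0 ≤ l 1 := intervalIntegral.integral_nonneg zero_le_one fun _ _ => norm_nonneg _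
  calc (K + K ^ 2) * M * L * l 1 ≤ (K + K ^ 2) * (2 * ‖a 0‖) * L * L := by gcongr
    _ = _ := by ring

theorem exists_bound_and_lipschitz_of_contDiffAt {V : Type*} [NormedAddCommGroup V]
    [NormedSpace ℝ V] {f : F → V} {u : F} (hf : ContDiffAt ℝ 1 f u) :
    ∃ K : ℝ, 0 ≤ K ∧ ∃ D ∈ 𝓝 u, (∀ x ∈ D, ‖f x‖ ≤ K) ∧
      ∀ x ∈ D, ∀ y ∈ D, ‖f x - f y‖ ≤ K * ‖x - y‖ := by
  obtain ⟨K, t, ht, hK⟩ := hf.exists_lipschitzOnWith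
  have hb := hf.continuousAt.norm.eventually_lt_const (lt_add_one _)
  refine ⟨max K (‖f u‖ + 1), le_max_of_le_left K.2, t ∩ {x | ‖f x‖ < ‖f u‖ + 1},
    Filter.inter_mem ht hb, fun x hx => le_max_of_le_right (le_of_lt hx.2), fun x hx y hy => ?_⟩
  exact (hK.norm_sub_le hx.1 hy.1).trans
    (mul_le_mul_of_nonneg_right (le_max_left _ _) (norm_nonneg _))

/-- A field that is transported along short curves up to a quadratic error is differentiable, and
it is parallel: its derivative is given by the connection form `B`. -/
theorem hasFDerivAt_of_norm_sub_le_sq {A : F → F} {B : F → F →L[ℝ] F →L[ℝ] F} {w : F} {C : ℝ}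
    (h : ∀ᶠ w' in 𝓝 w, ‖A w' - A w + B w (w' - w) (A w)‖ ≤ C * ‖w' - w‖ ^ 2) :
    HasFDerivAt A (-(B w).flip (A w)) w := by
  rw [hasFDerivAt_iff_isLittleO]
  have hO : (fun w' => A w' - A w - (-(B w).flip (A w)) (w' - w)) =O[𝓝 w]
      fun w' => ‖w' - w‖ ^ 2 := by
    refine Asymptotics.IsBigO.of_bound C ?_
    filter_upwards [h] with w' hw'
    have e : A w' - A w - (-(B w).flip (A w)) (w' - w) = A w' - A w + B w (w' - w) (A w) := by
      simp only [neg_apply, ContinuousLinearMap.flip_apply, sub_neg_eq_add]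
    rw [e, norm_pow, norm_norm]
    exact hw'
  refine hO.trans_isLittleO ?_
  have : (fun w' : F => ‖w' - w‖ ^ 2) =o[𝓝 w] fun w' => w' - w := by
    have := (Asymptotics.isLittleO_norm_pow_id (E' := F) one_lt_two).comp_tendsto
      (tendsto_sub_nhds_zero_iff.2 (Filter.tendsto_id (α := F) (x := 𝓝 w)))
    simpa [Function.comp_def] using this
  exact this

/-- The integrability condition of the equation `A' = -B(·, A)`: the curvature of the connection
form `B` annihilates `A`. It is the symmetry of the second derivative of `A`. -/
theorem curvature_apply_eq_zero {A : F → F} {B : F → F →L[ℝ] F →L[ℝ] F} {w : F}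
    (hA : ∀ᶠ x in 𝓝 w, HasFDerivAt A (-(B x).flip (A x)) x) (hB : DifferentiableAt ℝ B w)
    (p q : F) :
    fderiv ℝ B w p q (A w) - fderiv ℝ B w q p (A w)
      + (B w p (B w q (A w)) - B w q (B w p (A w))) = 0 := by
  have hAw := hA.self_of_nhds
  have hflip : HasFDerivAt (fun x => (B x).flip)
      ((ContinuousLinearMap.flipₗᵢ ℝ F F F).toLinearIsometry.toContinuousLinearMap.comp
        (fderiv ℝ B w)) w :=
    (ContinuousLinearMap.flipₗᵢ ℝ F F F).toLinearIsometry.toContinuousLinearMap.hasFDerivAt.comp w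
      hB.hasFDerivAt
  have h2 := (hflip.clm_apply hAw).neg
  have hsymm := second_derivative_symmetric_of_eventually hA h2 p q
  simp only [neg_apply, add_apply, ContinuousLinearMap.coe_comp, Function.comp_apply,
    ContinuousLinearMap.flip_apply, map_neg, LinearIsometry.coe_toContinuousLinearMap,
    LinearIsometryEquiv.coe_toLinearIsometry,
    ContinuousLinearMap.coe_flipₗᵢ] at hsymm
  have e : ∀ a b c d : F, -(-a + b) = -(-c + d) → b - d + (c - a) = 0 := by
    intro a b c d h
    have := neg_injective h
    rw [← sub_eq_zero] at this
    rw [← this]; abel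
  exact e _ _ _ _ hsymm

end Analysis

/-! ### The connection form and the curvature in coordinates -/

section Connection

variable {m : ℕ}

/-- The connection form of the Levi-Civita connection in coordinates: `christoffelVec G u` as a
bounded bilinear map, so that a field `a` along a curve `u` is parallel iff
`a' = -connForm G u u' a`. -/
noncomputable def connForm (G : E m → Matrix (Fin m) (Fin m) ℝ) (u : E m) :
    E m →L[ℝ] E m →L[ℝ] E m :=
  ∑ i, ∑ j, ∑ k, christoffel G k i j u •
    (EuclideanSpace.proj i : E m →L[ℝ] ℝ).smulRight
      ((EuclideanSpace.proj j : E m →L[ℝ] ℝ).smulRight (EuclideanSpace.single k (1 : ℝ)))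

theorem connForm_apply (G : E m → Matrix (Fin m) (Fin m) ℝ) (u a b : E m) :
    connForm G u a b = christoffelVec G u a b := by
  ext l
  simp [connForm, christoffelVec, mul_assoc, Finset.sum_apply, Pi.single_apply]

theorem connForm_single (G : E m → Matrix (Fin m) (Fin m) ℝ) (u : E m) (i j l : Fin m) :
    connForm G u (EuclideanSpace.single i 1) (EuclideanSpace.single j 1) l
      = christoffel G l i j u := by
  simp [connForm_apply, christoffelVec]

theorem connForm_single_left (G : E m → Matrix (Fin m) (Fin m) ℝ) (u b : E m) (i l : Fin m) :
    connForm G u (EuclideanSpace.single i 1) b l = ∑ p, christoffel G l i p u * b p := by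
  simp [connForm_apply, christoffelVec]

theorem contDiffAt_smul_vector {V W : Type*} [NormedAddCommGroup V] [NormedSpace ℝ V]
    [NormedAddCommGroup W] [NormedSpace ℝ W] {c : W → ℝ} {u : W} {n : ℕ∞ω}
    (hc : ContDiffAt ℝ n c u) (T : V) : ContDiffAt ℝ n (fun v => c v • T) u :=
  hc.smul contDiffAt_const

theorem contDiffAt_connForm {G : E m → Matrix (Fin m) (Fin m) ℝ} {u : E m} {n : ℕ∞ω}
    (h : ∀ k i j, ContDiffAt ℝ n (christoffel G k i j) u) :
    ContDiffAt ℝ n (connForm G) u := by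
  unfold connForm
  exact ContDiffAt.sum fun i _ => ContDiffAt.sum fun j _ => ContDiffAt.sum fun k _ =>
    contDiffAt_smul_vector (h k i j) _

/-- The Riemann tensor is the curvature of the connection form. -/
theorem riemann_eq_connForm {G : E m → Matrix (Fin m) (Fin m) ℝ} {u : E m}
    (h : DifferentiableAt ℝ (connForm G) u) (l i j k : Fin m) :
    let e : Fin m → E m := fun i => EuclideanSpace.single i 1
    riemann G l i j k u =
      (fderiv ℝ (connForm G) u (e i) (e j) (e k) - fderiv ℝ (connForm G) u (e j) (e i) (e k)
        + (connForm G u (e i) (connForm G u (e j) (e k))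
          - connForm G u (e j) (connForm G u (e i) (e k)))) l := by
  intro e
  have hpd : ∀ p j k l, partialD p (christoffel G l j k) u
      = fderiv ℝ (connForm G) u (e p) (e j) (e k) l := by
    intro p j k l
    have e1 : christoffel G l j k = fun v => connForm G v (e j) (e k) l := by
      funext v
      exact (connForm_single G v j k l).symm
    have h1 := ((h.hasFDerivAt.clm_apply (hasFDerivAt_const (e j) u)).clm_apply
      (hasFDerivAt_const (e k) u))
    have h2 := hasFDerivWithinAt_univ.1 (hasFDerivWithinAt_euclidean.1 h1.hasFDerivWithinAt l)
    rw [partialD, e1, h2.fderiv]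
    simp [e]
  simp only [riemann, hpd, PiLp.add_apply, PiLp.sub_apply, Finset.sum_sub_distrib]
  congr 1
  rw [connForm_single_left, connForm_single_left]
  simp only [e, connForm_single]

theorem contDiffAt_partialD {f : E m → ℝ} {u : E m} (hf : ContDiffAt ℝ ∞ f u) (k : Fin m) :
    ContDiffAt ℝ ∞ (partialD k f) u := by
  unfold partialD
  exact (hf.fderiv_right (m := ∞) (by simp)).clm_apply contDiffAt_const

theorem contDiffAt_det {ι κ : Type*} [Fintype ι] [DecidableEq ι] [NormedAddCommGroup κ]
    [NormedSpace ℝ κ] {G : κ → Matrix ι ι ℝ} {u : κ} {n : ℕ∞ω}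
    (h : ∀ i j, ContDiffAt ℝ n (fun v => G v i j) u) :
    ContDiffAt ℝ n (fun v => (G v).det) u := by
  simp only [Matrix.det_apply']
  exact ContDiffAt.sum fun σ _ => contDiffAt_const.mul (contDiffAt_prod fun i _ => h _ _)

theorem contDiffAt_inv_apply {ι κ : Type*} [Fintype ι] [DecidableEq ι] [NormedAddCommGroup κ]
    [NormedSpace ℝ κ] {G : κ → Matrix ι ι ℝ} {u : κ} {n : ℕ∞ω}
    (h : ∀ i j, ContDiffAt ℝ n (fun v => G v i j) u) (hdet : (G u).det ≠ 0) (i j : ι) :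
    ContDiffAt ℝ n (fun v => (G v)⁻¹ i j) u := by
  simp only [Matrix.inv_def, Matrix.smul_apply, Ring.inverse_eq_inv', Matrix.adjugate_apply,
    smul_eq_mul]
  refine ((contDiffAt_det h).inv hdet).mul (contDiffAt_det fun a b => ?_)
  by_cases hab : a = j
  · simpa [Matrix.updateRow_apply, hab] using contDiffAt_const
  · simpa [Matrix.updateRow_apply, hab] using h a b

theorem contDiffAt_christoffel {G : E m → Matrix (Fin m) (Fin m) ℝ} {u : E m}
    (h : ∀ i j, ContDiffAt ℝ ∞ (fun v => G v i j) u) (hdet : (G u).det ≠ 0) (k i j : Fin m) :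
    ContDiffAt ℝ ∞ (christoffel G k i j) u := by
  unfold christoffel
  exact contDiffAt_const.mul <| ContDiffAt.sum fun l _ =>
    (contDiffAt_inv_apply h hdet k l).mul
      (((contDiffAt_partialD (h j l) i).add (contDiffAt_partialD (h i l) j)).sub
        (contDiffAt_partialD (h i j) l))

end Connection

/-! ### Local retractions onto a submanifold -/

section Retraction

variable {d m : ℕ} {N : Type*} [TopologicalSpace N] [ChartedSpace (E d) N]

variable (d) in
/-- `q : O → U` is a `C^1` left inverse of the local parametrization `ψ : U → S`, defined on an
open subset `O` of the ambient manifold such that `ψ(U) = S ∩ O`. It expresses the regularity of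
the coordinates `ψ⁻¹` on `S` through that of a function on the ambient manifold. -/
structure IsLocalRetraction (S : Set N) (ψ : E m → N) (U : Set (E m)) (q : N → E m)
    (O : Set N) : Prop where
  isOpen_source : IsOpen U
  isOpen_domain : IsOpen O
  smooth_param : ContMDiffOn (𝓡 m) (𝓡 d) ∞ ψ U
  smooth : ContMDiffOn (𝓡 d) (𝓡 m) 1 q O
  mem_domain : ∀ u ∈ U, ψ u ∈ O
  mem : ∀ u ∈ U, ψ u ∈ S
  left_inv : ∀ u ∈ U, q (ψ u) = u
  mem_source : ∀ x ∈ S, x ∈ O → q x ∈ U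
  right_inv : ∀ x ∈ S, x ∈ O → ψ (q x) = x

theorem IsLocalRetraction.contMDiffAt_param {S : Set N} {ψ : E m → N} {U : Set (E m)}
    {q : N → E m} {O : Set N} (h : IsLocalRetraction d S ψ U q O) {u : E m} (hu : u ∈ U) :
    ContMDiffAt (𝓡 m) (𝓡 d) ∞ ψ u :=
  (h.smooth_param u hu).contMDiffAt (h.isOpen_source.mem_nhds hu)

theorem IsLocalRetraction.mdifferentiableAt_param {S : Set N} {ψ : E m → N} {U : Set (E m)}
    {q : N → E m} {O : Set N} (h : IsLocalRetraction d S ψ U q O) {u : E m} (hu : u ∈ U) :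
    MDifferentiableAt (𝓡 m) (𝓡 d) ψ u :=
  (h.contMDiffAt_param hu).mdifferentiableAt (by simp)

theorem IsLocalRetraction.contMDiffAt {S : Set N} {ψ : E m → N} {U : Set (E m)}
    {q : N → E m} {O : Set N} (h : IsLocalRetraction d S ψ U q O) {x : N} (hx : x ∈ O) :
    ContMDiffAt (𝓡 d) (𝓡 m) 1 q x :=
  (h.smooth x hx).contMDiffAt (h.isOpen_domain.mem_nhds hx)

theorem IsLocalRetraction.mdifferentiableAt {S : Set N} {ψ : E m → N} {U : Set (E m)}
    {q : N → E m} {O : Set N} (h : IsLocalRetraction d S ψ U q O) {x : N} (hx : x ∈ O) :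
    MDifferentiableAt (𝓡 d) (𝓡 m) q x :=
  (h.contMDiffAt hx).mdifferentiableAt one_ne_zero

namespace IsLocalRetraction

variable {S : Set N} {ψ : E m → N} {U : Set (E m)} {q : N → E m} {O : Set N}

theorem mfderiv_mfderiv_param (h : IsLocalRetraction d S ψ U q O) {u : E m} (hu : u ∈ U)
    (v : E m) : mfderiv (𝓡 d) (𝓡 m) q (ψ u) (mfderiv (𝓡 m) (𝓡 d) ψ u v) = v := by
  have h1 := mfderiv_comp u (h.mdifferentiableAt (h.mem_domain u hu)) (h.mdifferentiableAt_param hu)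
  have h2 : q ∘ ψ =ᶠ[𝓝 u] id := by
    filter_upwards [h.isOpen_source.mem_nhds hu] with w hw using h.left_inv w hw
  have h3 := (h2.mfderiv_eq (I := 𝓡 m) (I' := 𝓡 m)).symm.trans h1
  have h4 := congrArg (fun T : E m →L[ℝ] E m => T v) h3
  simp only [mfderiv_id] at h4
  exact h4.symm

/-- The velocities of curves in `S` are in the range of the differential of `ψ`. The two sides lie
in the tangent spaces at `ψ (q (γ 0))` and at `γ 0`, which are both `ℝ^d` by definition, and are
compared there. -/
theorem mfderiv_param_mfderiv_velocity (h : IsLocalRetraction d S ψ U q O) {γ : ℝ → N}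
    (hγ : MDifferentiableAt 𝓘(ℝ, ℝ) (𝓡 d) γ 0) (hS : ∀ᶠ t in 𝓝 (0 : ℝ), γ t ∈ S) (hO : γ 0 ∈ O) :
    (mfderiv (𝓡 m) (𝓡 d) ψ (q (γ 0)) (mfderiv (𝓡 d) (𝓡 m) q (γ 0)
      (mfderiv 𝓘(ℝ, ℝ) (𝓡 d) γ 0 (1 : ℝ))) : E d) = mfderiv 𝓘(ℝ, ℝ) (𝓡 d) γ 0 (1 : ℝ) := by
  have hev : ψ ∘ q ∘ γ =ᶠ[𝓝 0] γ := by
    filter_upwards [hS, hγ.continuousAt.preimage_mem_nhds (h.isOpen_domain.mem_nhds hO)]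
      with t ht1 ht2 using h.right_inv _ ht1 ht2
  have hq := h.mdifferentiableAt hO
  have hqγ : MDifferentiableAt 𝓘(ℝ, ℝ) (𝓡 m) (q ∘ γ) 0 := hq.comp 0 hγ
  have hψ := h.mdifferentiableAt_param (h.mem_source _ hS.self_of_nhds hO)
  have h1 := mfderiv_comp (0 : ℝ) (f := q ∘ γ) hψ hqγ
  have h2 := mfderiv_comp (0 : ℝ) hq hγ
  have h3 := hev.mfderiv_eq (I := 𝓘(ℝ, ℝ)) (I' := 𝓡 d)
  rw [h2] at h1
  have h4 := congrArg (fun T : ℝ →L[ℝ] E d => T 1) (h1.symm.trans h3)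
  exact h4

theorem mfderiv_param_mfderiv (h : IsLocalRetraction d S ψ U q O) {x : N} (hx : x ∈ O)
    {v : TangentSpace (𝓡 d) x} (hv : v ∈ tangentSub d S x) :
    (mfderiv (𝓡 m) (𝓡 d) ψ (q x) (mfderiv (𝓡 d) (𝓡 m) q x v) : E d) = v := by
  set T : E d →L[ℝ] E d := ContinuousLinearMap.comp (mfderiv (𝓡 m) (𝓡 d) ψ (q x))
    (mfderiv (𝓡 d) (𝓡 m) q x)
  change T v = v
  refine Submodule.span_induction (p := fun v _ => T v = v) ?_ (map_zero T) ?_ ?_ hv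
  · rintro v ⟨γ, hγ, hS, hv⟩
    -- generalize over `⟨x, v⟩` to eliminate the equality in the tangent bundle
    have key : ∀ p : TangentBundle (𝓡 d) N, p.1 ∈ O →
        (⟨γ 0, mfderiv 𝓘(ℝ, ℝ) (𝓡 d) γ 0 (1 : ℝ)⟩ : TangentBundle (𝓡 d) N) = p →
        (mfderiv (𝓡 m) (𝓡 d) ψ (q p.1) (mfderiv (𝓡 d) (𝓡 m) q p.1 p.2) : E d) = p.2 := by
      rintro p hp rfl
      exact h.mfderiv_param_mfderiv_velocity (hγ.mdifferentiableAt (by simp)) hS hp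
    exact key ⟨x, v⟩ hx hv
  · intro v w _ _ hv hw
    exact (map_add T v w).trans (congrArg₂ (fun a b : E d => a + b) hv hw)
  · intro c v _ hv
    exact (map_smul T c v).trans (congrArg (fun a : E d => c • a) hv)

theorem mk_mfderiv_param_mfderiv (h : IsLocalRetraction d S ψ U q O) {x : N} (hxS : x ∈ S)
    (hx : x ∈ O) {v : TangentSpace (𝓡 d) x} (hv : v ∈ tangentSub d S x) :
    (⟨ψ (q x), mfderiv (𝓡 m) (𝓡 d) ψ (q x) (mfderiv (𝓡 d) (𝓡 m) q x v)⟩ :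
      TangentBundle (𝓡 d) N) = ⟨x, v⟩ :=
  TotalSpace.ext (h.right_inv x hxS hx) (heq_of_eq (h.mfderiv_param_mfderiv hx hv))

theorem mfderiv_param_mem_tangentSub (h : IsLocalRetraction d S ψ U q O) {u : E m} (hu : u ∈ U)
    (v : E m) : mfderiv (𝓡 m) (𝓡 d) ψ u v ∈ tangentSub d S (ψ u) := by
  refine Submodule.subset_span ⟨fun t => ψ (u + t • v), ?_, ?_, ?_⟩
  · have h1 : ContMDiffAt 𝓘(ℝ, ℝ) (𝓡 m) ∞ (fun t : ℝ => u + t • v) 0 :=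
      (by fun_prop : ContDiff ℝ ∞ fun t : ℝ => u + t • v).contMDiff.contMDiffAt
    refine ContMDiffAt.comp (0 : ℝ) ?_ h1
    simpa using h.contMDiffAt_param hu
  · have hc : ContinuousAt (fun t : ℝ => u + t • v) 0 := by fun_prop
    have : ∀ᶠ t : ℝ in 𝓝 0, u + t • v ∈ U :=
      hc.preimage_mem_nhds (h.isOpen_source.mem_nhds (by simpa using hu))
    filter_upwards [this] with t ht using h.mem _ ht
  · have h0 : u + (0 : ℝ) • v = u := by simp
    have hl : HasFDerivAt (fun t : ℝ => u + t • v)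
        ((ContinuousLinearMap.id ℝ ℝ).smulRight v) 0 :=
      ((hasFDerivAt_id (𝕜 := ℝ) (0 : ℝ)).smul_const v).const_add u
    have h1 := (hl.hasMFDerivAt).mdifferentiableAt
    have hψ : MDifferentiableAt (𝓡 m) (𝓡 d) ψ (u + (0 : ℝ) • v) := by
      rw [h0]; exact h.mdifferentiableAt_param hu
    have h2 := mfderiv_comp (0 : ℝ) (f := fun t : ℝ => u + t • v) hψ h1
    rw [hl.hasMFDerivAt.mfderiv] at h2
    have h3 := congrArg (fun T : ℝ →L[ℝ] E d => T 1) h2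
    refine TotalSpace.ext (congrArg ψ h0) (heq_of_eq ?_)
    refine h3.trans ?_
    have h5 : ∀ w : E m, w = u → (mfderiv (𝓡 m) (𝓡 d) ψ w ((1 : ℝ) • v) : E d)
        = mfderiv (𝓡 m) (𝓡 d) ψ u v := by
      rintro w rfl
      rw [one_smul]
    exact h5 _ h0

end IsLocalRetraction

variable [IsManifold (𝓡 d) ∞ N]

/-- An immersion has a local left inverse, by the inverse function theorem applied to its
composition with a linear left inverse of its differential. -/
theorem exists_contMDiffAt_leftInverse {ψ : E m → N} {u₀ : E m}
    (hψ : ContMDiffAt (𝓡 m) (𝓡 d) ∞ ψ u₀)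
    (hinj : Function.Injective (mfderiv (𝓡 m) (𝓡 d) ψ u₀)) :
    ∃ q : N → E m, ContMDiffAt (𝓡 d) (𝓡 m) 1 q (ψ u₀) ∧ ∀ᶠ u in 𝓝 u₀, q (ψ u) = u := by
  set e := extChartAt (𝓡 d) (ψ u₀) with he
  have hes : ContMDiffAt (𝓡 d) 𝓘(ℝ, E d) ∞ e (ψ u₀) := contMDiffAt_extChartAt
  have hf : ContDiffAt ℝ ∞ (e ∘ ψ) u₀ := contMDiffAt_iff_contDiffAt.1 (hes.comp u₀ hψ)
  have hfd : fderiv ℝ (e ∘ ψ) u₀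
      = (mfderiv (𝓡 d) 𝓘(ℝ, E d) e (ψ u₀)).comp (mfderiv (𝓡 m) (𝓡 d) ψ u₀) := by
    rw [← mfderiv_eq_fderiv]
    exact mfderiv_comp u₀ (hes.mdifferentiableAt (by simp)) (hψ.mdifferentiableAt (by simp))
  have hfinj : Function.Injective (fderiv ℝ (e ∘ ψ) u₀) := by
    rw [hfd]
    exact (isInvertible_mfderiv_extChartAt (mem_extChartAt_source _)).injective.comp hinj
  -- `q` is `(L ∘ e ∘ ψ)⁻¹ ∘ L ∘ e`, where `e` is a chart and `L` is a left inverse of `d(e ∘ ψ)`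
  obtain ⟨L, hL⟩ := LinearMap.exists_leftInverse_of_injective
    (fderiv ℝ (e ∘ ψ) u₀ : E m →ₗ[ℝ] E d) (LinearMap.ker_eq_bot.2 hfinj)
  set L' : E d →L[ℝ] E m := LinearMap.toContinuousLinearMap L
  have hg : ContDiffAt ℝ 1 (L' ∘ e ∘ ψ) u₀ :=
    L'.contDiff.contDiffAt.comp u₀ (hf.of_le (by simp))
  have hg' : HasFDerivAt (L' ∘ e ∘ ψ) (ContinuousLinearEquiv.refl ℝ (E m) : E m →L[ℝ] E m) u₀ := by
    have h1 := L'.hasFDerivAt.comp u₀ (hf.differentiableAt (by simp)).hasFDerivAt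
    have h2 : L'.comp (fderiv ℝ (e ∘ ψ) u₀)
        = (ContinuousLinearEquiv.refl ℝ (E m) : E m →L[ℝ] E m) :=
      ContinuousLinearMap.ext fun v => LinearMap.congr_fun hL v
    exact h2 ▸ h1
  refine ⟨hg.localInverse hg' one_ne_zero ∘ L' ∘ e, ?_, ?_⟩
  · have h1 : ContDiffAt ℝ 1 (hg.localInverse hg' one_ne_zero) (L' (e (ψ u₀))) :=
      hg.to_localInverse hg' one_ne_zero
    have h2 : ContDiffAt ℝ 1 (hg.localInverse hg' one_ne_zero ∘ L') (e (ψ u₀)) :=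
      h1.comp _ L'.contDiff.contDiffAt
    exact h2.contMDiffAt.comp (ψ u₀) (hes.of_le (by simp))
  · exact (hg.hasStrictFDerivAt' hg' one_ne_zero).eventually_left_inverse

theorem IsLocalParam.exists_isLocalRetraction {S : Set N} {ψ : E m → N} {U : Set (E m)}
    (h : IsLocalParam d S ψ U) {u₀ : E m} (hu₀ : u₀ ∈ U) :
    ∃ U' ⊆ U, ∃ (q : N → E m) (O : Set N), u₀ ∈ U' ∧ IsLocalRetraction d S ψ U' q O := by
  have hU : U ∈ 𝓝 u₀ := h.isOpen.mem_nhds hu₀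
  have hψ := (h.smooth u₀ hu₀).contMDiffAt hU
  obtain ⟨q, hq, hleft⟩ := exists_contMDiffAt_leftInverse hψ (h.immersion u₀ hu₀)
  obtain ⟨O₀, hO₀, hO₀o, hψO₀⟩ := eventually_nhds_iff.1
    ((contMDiffAt_iff_contMDiffAt_nhds (by simp)).1 hq)
  have hψO : ∀ᶠ u in 𝓝 u₀, ψ u ∈ O₀ :=
    hψ.continuousAt.preimage_mem_nhds (hO₀o.mem_nhds hψO₀)
  obtain ⟨U', hU', hU'o, hu₀'⟩ := eventually_nhds_iff.1
    (hleft.and (hψO.and (Filter.eventually_mem_set.2 hU)))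
  obtain ⟨W, hWo, hW⟩ := h.embedding.isOpen_iff.1 (hU'o.preimage continuous_subtype_val :
    IsOpen ((Subtype.val : U → E m) ⁻¹' U'))
  obtain ⟨W₀, hW₀o, hW₀⟩ := h.image
  have hmem : ∀ u ∈ U', u ∈ U := fun u hu => (hU' u hu).2.2
  have hWmem : ∀ u (hu : u ∈ U), ψ u ∈ W ↔ u ∈ U' := fun u hu =>
    Set.ext_iff.1 hW ⟨u, hu⟩
  -- `W` is where the topology of `S` being the induced one enters: `ψ(U) ∩ W = ψ(U')`
  have key : ∀ x ∈ S, x ∈ O₀ ∩ (W ∩ W₀) → ∃ u ∈ U', ψ u = x := by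
    rintro x hxS ⟨-, hxW, hxW₀⟩
    obtain ⟨u, hu, rfl⟩ : x ∈ ψ '' U := hW₀ ▸ ⟨hxS, hxW₀⟩
    exact ⟨u, (hWmem u hu).1 hxW, rfl⟩
  have himg : ∀ u ∈ U, ψ u ∈ S ∩ W₀ := fun u hu => hW₀ ▸ Set.mem_image_of_mem ψ hu
  refine ⟨U', hmem, q, O₀ ∩ (W ∩ W₀), hu₀',
    { isOpen_source := hU'o
      isOpen_domain := hO₀o.inter (hWo.inter hW₀o)
      smooth_param := h.smooth.mono hmem
      smooth := fun x hx => (hO₀ x hx.1).contMDiffWithinAt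
      mem_domain := fun u hu => ⟨(hU' u hu).2.1, (hWmem u (hmem u hu)).2 hu,
        (himg u (hmem u hu)).2⟩
      mem := fun u hu => (himg u (hmem u hu)).1
      left_inv := fun u hu => (hU' u hu).1
      mem_source := fun x hxS hx => ?_
      right_inv := fun x hxS hx => ?_ }⟩
  · obtain ⟨u, hu, rfl⟩ := key x hxS hx
    rwa [(hU' u hu).1]
  · obtain ⟨u, hu, rfl⟩ := key x hxS hx
    rw [(hU' u hu).1]

end Retraction

/-! ### The induced metric in coordinates -/

section Metric

variable {d m : ℕ} {N : Type*} [TopologicalSpace N] [ChartedSpace (E d) N]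

/-- The coordinate fields `∂_i ψ` are smooth fields along `ψ`. -/
theorem contMDiffOn_mfderiv_const [IsManifold (𝓡 d) ∞ N] {ψ : E m → N}
    {U : Set (E m)} (hU : IsOpen U) (hψ : ContMDiffOn (𝓡 m) (𝓡 d) ∞ ψ U) (v : E m) :
    ContMDiffOn (𝓡 m) (𝓡 d).tangent ∞
      (fun u => (⟨ψ u, mfderiv (𝓡 m) (𝓡 d) ψ u v⟩ : TangentBundle (𝓡 d) N)) U := by
  have h1 := hψ.contMDiffOn_tangentMapWithin (m := ∞) (by simp) hU.uniqueMDiffOn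
  have h2 : ContMDiff (𝓡 m) (𝓡 m).tangent ∞
      (fun u : E m => (⟨u, v⟩ : TangentBundle (𝓡 m) (E m))) :=
    (contMDiff_vectorSpace_iff_contDiff (V := fun _ => v)).2 contDiff_const
  refine (h1.comp (s := U) h2.contMDiffOn fun u hu => hu).congr fun u hu => ?_
  have : mfderivWithin (𝓡 m) (𝓡 d) ψ U u = mfderiv (𝓡 m) (𝓡 d) ψ u :=
    mfderivWithin_of_isOpen hU hu
  simp only [Function.comp_apply, tangentMapWithin, this]

variable [RiemannianBundle (fun x : N => TangentSpace (𝓡 d) x)]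

theorem norm_sq_mfderiv_eq_gram (ψ : E m → N) (u v : E m) :
    ‖mfderiv (𝓡 m) (𝓡 d) ψ u v‖ ^ 2 = ∑ i, ∑ j, v i * (gram d ψ u i j * v j) := by
  have hv : v = ∑ i, v i • EuclideanSpace.single i (1 : ℝ) := by
    ext j
    simp [Pi.single_apply]
  have h1 : mfderiv (𝓡 m) (𝓡 d) ψ u v
      = ∑ i, v i • mfderiv (𝓡 m) (𝓡 d) ψ u (EuclideanSpace.single i (1 : ℝ)) := by
    conv_lhs => rw [hv]
    refine (map_sum (mfderiv (𝓡 m) (𝓡 d) ψ u) _ _).trans ?_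
    exact Finset.sum_congr rfl fun i _ => map_smul (mfderiv (𝓡 m) (𝓡 d) ψ u) _ _
  rw [h1, ← real_inner_self_eq_norm_sq, sum_inner]
  refine Finset.sum_congr rfl fun i _ => ?_
  rw [inner_sum]
  refine Finset.sum_congr rfl fun j _ => ?_
  rw [real_inner_smul_left, real_inner_smul_right, gram]
  ring

theorem det_gram_ne_zero {ψ : E m → N} {u : E m}
    (h : Function.Injective (mfderiv (𝓡 m) (𝓡 d) ψ u)) : (gram d ψ u).det ≠ 0 := by
  intro hdet
  obtain ⟨v, hv, hv0⟩ := Matrix.exists_mulVec_eq_zero_iff.2 hdet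
  have h1 : ‖mfderiv (𝓡 m) (𝓡 d) ψ u (WithLp.toLp 2 v)‖ ^ 2 = 0 := by
    rw [norm_sq_mfderiv_eq_gram]
    refine Finset.sum_eq_zero fun i _ => ?_
    rw [← Finset.mul_sum]
    have : ∑ j, gram d ψ u i j * v j = 0 := congrFun hv0 i
    simp [this]
  have h2 : mfderiv (𝓡 m) (𝓡 d) ψ u (WithLp.toLp 2 v) = 0 := by simpa using h1
  have h3 : (WithLp.toLp 2 v : E m) = 0 := h (h2.trans (map_zero (mfderiv (𝓡 m) (𝓡 d) ψ u)).symm)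
  exact hv (by simpa using h3)

variable [IsManifold (𝓡 d) ∞ N]

theorem contDiffAt_gram [IsContMDiffRiemannianBundle (𝓡 d) ∞ (E d)
    (fun x : N => TangentSpace (𝓡 d) x)] {ψ : E m → N} {U : Set (E m)} (hU : IsOpen U)
    (hψ : ContMDiffOn (𝓡 m) (𝓡 d) ∞ ψ U) {u : E m} (hu : u ∈ U) (i j : Fin m) :
    ContDiffAt ℝ ∞ (fun w => gram d ψ w i j) u := by
  have h := (ContMDiffOn.inner_bundle (contMDiffOn_mfderiv_const hU hψ (EuclideanSpace.single i 1))
    (contMDiffOn_mfderiv_const hU hψ (EuclideanSpace.single j 1))) u hu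
  exact contMDiffAt_iff_contDiffAt.1 (h.contMDiffAt (hU.mem_nhds hu))

/-- The differential of a smooth parametrization is locally bounded. -/
theorem eventually_norm_mfderiv_param_le [IsContMDiffRiemannianBundle (𝓡 d) ∞ (E d)
    (fun x : N => TangentSpace (𝓡 d) x)] {ψ : E m → N} {U : Set (E m)} (hU : IsOpen U)
    (hψ : ContMDiffOn (𝓡 m) (𝓡 d) ∞ ψ U) {u₀ : E m} (hu₀ : u₀ ∈ U) :
    ∃ C : ℝ, 0 ≤ C ∧ ∀ᶠ u in 𝓝 u₀, ∀ v : E m, ‖mfderiv (𝓡 m) (𝓡 d) ψ u v‖ ≤ C * ‖v‖ := by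
  have hc : ContinuousAt (fun u => ∑ i, ∑ j, |gram d ψ u i j|) u₀ :=
    tendsto_finsetSum _ fun i _ => tendsto_finsetSum _ fun j _ =>
      (contDiffAt_gram hU hψ hu₀ i j).continuousAt.abs
  set c : ℝ := (∑ i, ∑ j, |gram d ψ u₀ i j|) + 1
  have hc0 : 0 ≤ c := by positivity
  refine ⟨√c, Real.sqrt_nonneg _, ?_⟩
  filter_upwards [hc.eventually_lt_const (lt_add_one _)] with u hu v
  have hle : ∀ i, |v i| ≤ ‖v‖ := fun i => by simpa using PiLp.norm_apply_le v i
  have h1 : ‖mfderiv (𝓡 m) (𝓡 d) ψ u v‖ ^ 2 ≤ (√c * ‖v‖) ^ 2 := by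
    rw [norm_sq_mfderiv_eq_gram, mul_pow, Real.sq_sqrt hc0]
    calc ∑ i, ∑ j, v i * (gram d ψ u i j * v j)
        ≤ ∑ i, ∑ j, |gram d ψ u i j| * ‖v‖ ^ 2 := by
          refine Finset.sum_le_sum fun i _ => Finset.sum_le_sum fun j _ => ?_
          calc v i * (gram d ψ u i j * v j) ≤ |v i * (gram d ψ u i j * v j)| := le_abs_self _
            _ = |gram d ψ u i j| * (|v i| * |v j|) := by rw [abs_mul, abs_mul]; ring
            _ ≤ |gram d ψ u i j| * (‖v‖ * ‖v‖) := by gcongr <;> exact hle _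
            _ = _ := by ring
      _ = (∑ i, ∑ j, |gram d ψ u i j|) * ‖v‖ ^ 2 := by simp only [Finset.sum_mul]
      _ ≤ c * ‖v‖ ^ 2 := by gcongr
  exact (pow_le_pow_iff_left₀ (norm_nonneg _) (by positivity) two_ne_zero).1 h1

theorem isContinuousRiemannianBundle_of_contMDiff [h : IsContMDiffRiemannianBundle (𝓡 d) ∞ (E d)
    (fun x : N => TangentSpace (𝓡 d) x)] :
    IsContinuousRiemannianBundle (E d) (fun x : N => TangentSpace (𝓡 d) x) := by
  obtain ⟨g, hg, hg'⟩ := h.exists_contMDiff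
  exact ⟨g, hg.continuous, hg'⟩

variable (d) in
/-- The differential `T_y N → ℝ^m` of an `ℝ^m`-valued function. It is `mfderiv`, with values in
`ℝ^m` instead of a tangent space of `ℝ^m`, so that `ℝ^m` carries its usual norm. -/
noncomputable def vecDeriv (q : N → E m) (y : N) : TangentSpace (𝓡 d) y →L[ℝ] E m :=
  mfderiv (𝓡 d) (𝓡 m) q y

/-- The differential of a `C^1` map to a Euclidean space is locally bounded. -/
theorem eventually_norm_mfderiv_le [IsContMDiffRiemannianBundle (𝓡 d) ∞ (E d)
    (fun x : N => TangentSpace (𝓡 d) x)] {q : N → E m} {x : N}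
    (hq : ContMDiffAt (𝓡 d) (𝓡 m) 1 q x) :
    ∃ C : ℝ, 0 ≤ C ∧ ∀ᶠ y in 𝓝 x, ∀ v : TangentSpace (𝓡 d) y,
      ‖vecDeriv d q y v‖ ≤ C * ‖v‖ := by
  have := isContinuousRiemannianBundle_of_contMDiff (d := d) (N := N)
  obtain ⟨C₁, hC₁, h₁⟩ := eventually_norm_mfderiv_extChartAt_lt (𝓡 d) x
  set e := extChartAt (𝓡 d) x
  set Q : E d → E m := q ∘ e.symm
  have hQ : ContDiffAt ℝ 1 Q (e x) := by
    refine contMDiffAt_iff_contDiffAt.1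
      (ContMDiffAt.comp (I' := 𝓡 d) (g := q) (f := e.symm) (e x) ?_ ?_)
    · rwa [extChartAt_to_inv]
    · exact (contMDiffOn_extChartAt_symm (I := 𝓡 d) x _ (mem_extChartAt_target x)).contMDiffAt
        (extChartAt_target_mem_nhds x)
  have hcont : ContinuousAt (fun y => fderiv ℝ Q (e y)) x :=
    ContinuousAt.comp (f := e) (hQ.fderiv_right (m := 0) (by simp)).continuousAt
      (continuousAt_extChartAt x)
  have hQd : ∀ᶠ y in 𝓝 x, DifferentiableAt ℝ Q (e y) :=
    (continuousAt_extChartAt x).eventually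
      ((hQ.eventually (by simp)).mono fun y hy => hy.differentiableAt one_ne_zero)
  refine ⟨(‖fderiv ℝ Q (e x)‖ + 1) * C₁, by positivity, ?_⟩
  have hsrc := extChartAt_source_mem_nhds (I := 𝓡 d) x
  filter_upwards [h₁, hQd, hcont.norm.eventually_lt_const (lt_add_one _),
    eventually_mem_nhds_iff.2 hsrc] with y hy1 hy2 hy3 hy4 v
  have hey : MDifferentiableAt (𝓡 d) 𝓘(ℝ, E d) e y :=
    mdifferentiableAt_extChartAt (by simpa using mem_of_mem_nhds hy4)
  have heq : q =ᶠ[𝓝 y] Q ∘ e := by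
    filter_upwards [hy4] with z hz
    simp [Q, e.left_inv hz]
  have h2 : vecDeriv d q y = (fderiv ℝ Q (e y)).comp (vecDeriv d e y) := by
    refine heq.mfderiv_eq.trans ?_
    rw [← mfderiv_eq_fderiv]
    exact mfderiv_comp y hy2.mdifferentiableAt hey
  have h4 : ‖vecDeriv d e y v‖ ≤ C₁ * ‖v‖ := by
    -- the bound `hy1` is for the norm of `ℝ^d`, not for its Riemannian structure
    let _ := normedAddCommGroupTangentSpaceVectorSpace (e y)
    let _ := normedSpaceTangentSpaceVectorSpace (e y)
    exact ContinuousLinearMap.le_of_opNorm_le _ hy1.le v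
  rw [h2, ContinuousLinearMap.comp_apply]
  calc _ ≤ ‖fderiv ℝ Q (e y)‖ * ‖vecDeriv d e y v‖ := (fderiv ℝ Q (e y)).le_opNorm _
    _ ≤ (‖fderiv ℝ Q (e x)‖ + 1) * (C₁ * ‖v‖) := by gcongr
    _ = _ := by ring

end Metric

/-! ### The induced distance -/

section InducedDistance

variable {d m : ℕ} {N : Type*} [TopologicalSpace N] [ChartedSpace (E d) N]
  [RiemannianBundle (fun x : N => TangentSpace (𝓡 d) x)]

theorem inducedEDist_le_pathELength {S : Set N} {γ : ℝ → N}
    (hγ : ContMDiffOn 𝓘(ℝ, ℝ) (𝓡 d) 1 γ (Set.Icc 0 1)) (hS : Set.MapsTo γ (Set.Icc 0 1) S) :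
    inducedEDist d S (γ 0) (γ 1) ≤ Manifold.pathELength (𝓡 d) γ 0 1 :=
  iInf₂_le γ ⟨hγ, hS, rfl, rfl⟩

/-- The induced distance is also the infimum of the lengths of the `C^1` curves in `S` that are
constant near their endpoints; such curves can be concatenated. -/
theorem exists_locally_constant_of_inducedEDist_lt {S : Set N} {x y : N} {r : ENNReal} {a b : ℝ}
    (hr : inducedEDist d S x y < r) (hab : a < b) :
    ∃ γ : ℝ → N, γ a = x ∧ γ b = y ∧ ContMDiff 𝓘(ℝ, ℝ) (𝓡 d) 1 γ ∧ (∀ t, γ t ∈ S) ∧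
      Manifold.pathELength (𝓡 d) γ a b < r ∧ γ =ᶠ[𝓝 a] (fun _ => x) ∧ γ =ᶠ[𝓝 b] (fun _ => y) := by
  simp only [inducedEDist, iInf_lt_iff] at hr
  obtain ⟨γ, ⟨hγ, hγS, hγx, hγy⟩, hlen⟩ := hr
  -- reparametrize by a smooth step function that is constant outside of `[a', b'] ⊂ (a, b)`
  obtain ⟨a', haa', ha'b⟩ := exists_between hab
  obtain ⟨b', ha'b', hb'b⟩ := exists_between ha'b
  set η : ℝ → ℝ := fun t => Real.smoothTransition ((b' - a')⁻¹ * (t - a')) with hη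
  have hpos : 0 < b' - a' := sub_pos.2 ha'b'
  have hη0 : ∀ t < a', η t = 0 := fun t ht =>
    Real.smoothTransition.zero_of_nonpos
      (mul_nonpos_of_nonneg_of_nonpos (inv_nonneg.2 hpos.le) (by linarith))
  have hη1 : ∀ t, b' < t → η t = 1 := fun t ht => by
    refine Real.smoothTransition.one_of_one_le ?_
    rw [inv_mul_eq_div, one_le_div₀ hpos]
    linarith
  have hηsmooth : ContDiff ℝ 1 η := by
    refine Real.smoothTransition.contDiff.comp ?_
    fun_prop
  have hηmono : Monotone η := by
    refine Real.smoothTransition.monotone.comp fun t u htu => ?_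
    gcongr
  have hηIcc : ∀ t, η t ∈ Set.Icc (0 : ℝ) 1 := fun t =>
    ⟨Real.smoothTransition.nonneg _, Real.smoothTransition.le_one _⟩
  have hx : ∀ t < a', (γ ∘ η) t = x := fun t ht => by simp [hη0 t ht, hγx]
  have hy : ∀ t, b' < t → (γ ∘ η) t = y := fun t ht => by simp [hη1 t ht, hγy]
  refine ⟨γ ∘ η, hx a haa', hy b hb'b, ?_, fun t => hγS (hηIcc t), ?_, ?_, ?_⟩
  · rw [← contMDiffOn_univ]
    exact hγ.comp hηsmooth.contMDiff.contMDiffOn fun t _ => hηIcc t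
  · rw [Manifold.pathELength_comp_of_monotoneOn hab.le (hηmono.monotoneOn _)
      (hηsmooth.differentiable one_ne_zero).differentiableOn, hη0 a haa', hη1 b hb'b]
    · exact hlen
    · rw [hη0 a haa', hη1 b hb'b]
      exact hγ.mdifferentiableOn one_ne_zero
  · filter_upwards [Iio_mem_nhds haa'] with t ht using hx t ht
  · filter_upwards [Ioi_mem_nhds hb'b] with t ht using hy t ht

theorem inducedEDist_triangle {S : Set N} {x y z : N} :
    inducedEDist d S x z ≤ inducedEDist d S x y + inducedEDist d S y z := by
  refine le_of_forall_gt fun r hr => ?_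
  obtain ⟨u, hu, v, hv, huv⟩ := ENNReal.exists_add_lt_of_add_lt hr
  obtain ⟨γ₁, h₁0, h₁1, h₁, h₁S, h₁len, -, h₁c⟩ :=
    exists_locally_constant_of_inducedEDist_lt hu (half_pos one_pos)
  obtain ⟨γ₂, h₂0, h₂1, h₂, h₂S, h₂len, h₂c, -⟩ :=
    exists_locally_constant_of_inducedEDist_lt hv (half_lt_self one_pos)
  classical
  set γ : ℝ → N := Set.piecewise (Set.Iic (1 / 2)) γ₁ γ₂ with hγ
  have hγ0 : γ 0 = x := by simp [hγ, h₁0]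
  have hγ1 : γ 1 = z := by
    rw [hγ, Set.piecewise_eq_of_notMem _ _ _ (by norm_num), h₂1]
  have hγS : ∀ t, γ t ∈ S := fun t => by
    by_cases ht : t ∈ Set.Iic ((1 : ℝ) / 2)
    · rw [hγ, Set.piecewise_eq_of_mem _ _ _ ht]; exact h₁S t
    · rw [hγ, Set.piecewise_eq_of_notMem _ _ _ ht]; exact h₂S t
  have hle : inducedEDist d S (γ 0) (γ 1) ≤ Manifold.pathELength (𝓡 d) γ 0 1 :=
    inducedEDist_le_pathELength
      (ContMDiff.piecewise_Iic h₁ h₂ (h₁c.trans h₂c.symm)).contMDiffOn fun t _ => hγS t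
  rw [hγ0, hγ1] at hle
  refine hle.trans_lt (lt_trans ?_ huv)
  rw [← Manifold.pathELength_add (half_pos one_pos).le (half_lt_self (one_pos (α := ℝ))).le]
  refine ENNReal.add_lt_add ?_ ?_
  · rwa [Manifold.pathELength_congr (γ' := γ₁)]
    intro t ht
    exact Set.piecewise_eq_of_mem _ _ _ ht.2
  · rwa [Manifold.pathELength_congr_Ioo (γ' := γ₂)]
    intro t ht
    exact Set.piecewise_eq_of_notMem _ _ _ (not_le.2 ht.1)

theorem inducedEDist_param_le {S : Set N} {ψ : E m → N} {D : Set (E m)} {C : ℝ}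
    (hD : Convex ℝ D) (hS : ∀ u ∈ D, ψ u ∈ S)
    (hψ : ∀ u ∈ D, ContMDiffAt (𝓡 m) (𝓡 d) ∞ ψ u)
    (hbound : ∀ u ∈ D, ∀ v : E m, ‖mfderiv (𝓡 m) (𝓡 d) ψ u v‖ ≤ C * ‖v‖)
    {w w' : E m} (hw : w ∈ D) (hw' : w' ∈ D) :
    inducedEDist d S (ψ w) (ψ w') ≤ ENNReal.ofReal (C * ‖w' - w‖) := by
  set l : ℝ → E m := fun t => w + t • (w' - w) with hl
  have hlD : ∀ t ∈ Set.Icc (0 : ℝ) 1, l t ∈ D := fun t ht =>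
    hD.add_smul_sub_mem hw hw' ht
  have hls : ContMDiff 𝓘(ℝ, ℝ) (𝓡 m) 1 l :=
    (by fun_prop : ContDiff ℝ 1 l).contMDiff
  have hl' : ∀ t, HasFDerivAt l ((ContinuousLinearMap.id ℝ ℝ).smulRight (w' - w)) t := fun t =>
    ((hasFDerivAt_id (𝕜 := ℝ) t).smul_const (w' - w)).const_add w
  have h0 : l 0 = w := by simp [hl]
  have h1 : l 1 = w' := by simp [hl]
  have hle : inducedEDist d S ((ψ ∘ l) 0) ((ψ ∘ l) 1)
      ≤ Manifold.pathELength (𝓡 d) (ψ ∘ l) 0 1 := by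
    refine inducedEDist_le_pathELength (fun t ht => ?_) fun t ht => hS _ (hlD t ht)
    exact (((hψ _ (hlD t ht)).of_le (by simp)).comp t hls.contMDiffAt).contMDiffWithinAt
  simp only [Function.comp_apply, h0, h1] at hle
  refine hle.trans ?_
  rw [Manifold.pathELength_eq_lintegral_mfderiv_Icc]
  calc _ ≤ ∫⁻ _ in Set.Icc (0 : ℝ) 1, ENNReal.ofReal (C * ‖w' - w‖) := by
        refine MeasureTheory.setLIntegral_mono' measurableSet_Icc fun t ht => ?_
        have h2 := mfderiv_comp t (g := ψ) (f := l)
          ((hψ _ (hlD t ht)).mdifferentiableAt (by simp)) (hl' t).hasMFDerivAt.mdifferentiableAt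
        rw [(hl' t).hasMFDerivAt.mfderiv] at h2
        have h3 : mfderiv 𝓘(ℝ, ℝ) (𝓡 d) (ψ ∘ l) t (1 : ℝ)
            = mfderiv (𝓡 m) (𝓡 d) ψ (l t) (w' - w) := by
          rw [h2]
          change mfderiv (𝓡 m) (𝓡 d) ψ (l t) ((1 : ℝ) • (w' - w)) = _
          rw [one_smul]
        refine (congrArg (fun v : TangentSpace (𝓡 d) (ψ (l t)) => ‖v‖ₑ) h3).trans_le ?_
        rw [← ofReal_norm]
        exact ENNReal.ofReal_le_ofReal (hbound _ (hlD t ht) _)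
    _ = _ := by simp

end InducedDistance

theorem edist_le_pathELength {d : ℕ} {N : Type*} [PseudoEMetricSpace N] [ChartedSpace (E d) N]
    [RiemannianBundle (fun x : N => TangentSpace (𝓡 d) x)] [IsRiemannianManifold (𝓡 d) N]
    {γ : ℝ → N} (hγ : ContMDiffOn 𝓘(ℝ, ℝ) (𝓡 d) 1 γ (Set.Icc 0 1)) {t : ℝ}
    (ht : t ∈ Set.Icc (0 : ℝ) 1) :
    edist (γ 0) (γ t) ≤ Manifold.pathELength (𝓡 d) γ 0 1 := by
  rw [IsRiemannianManifold.out (I := 𝓡 d) (γ 0) (γ t)]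
  exact (Manifold.riemannianEDist_le_pathELength
    (hγ.mono (Set.Icc_subset_Icc_right ht.2)) rfl rfl ht.1).trans
    (Manifold.pathELength_mono le_rfl ht.2)

/-! ### Parallel transport in coordinates -/

section Transport

variable {d m : ℕ} {N : Type*} [MetricSpace N] [ChartedSpace (E d) N]

theorem IsLocalRetraction.hasDerivAt_comp {S : Set N} {ψ : E m → N} {U : Set (E m)}
    {q : N → E m} {O : Set N} (h : IsLocalRetraction d S ψ U q O) {γ : ℝ → N} {t : ℝ}
    (hγ : MDifferentiableAt 𝓘(ℝ, ℝ) (𝓡 d) γ t) (ht : γ t ∈ O) :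
    HasDerivAt (q ∘ γ) (vecDeriv d q (γ t) (mfderiv 𝓘(ℝ, ℝ) (𝓡 d) γ t (1 : ℝ))) t := by
  have h1 : HasFDerivAt (q ∘ γ)
      (ContinuousLinearMap.comp (vecDeriv d q (γ t)) (mfderiv 𝓘(ℝ, ℝ) (𝓡 d) γ t) : ℝ →L[ℝ] E m) t :=
    ((h.mdifferentiableAt ht).hasMFDerivAt.comp t hγ.hasMFDerivAt).hasFDerivAt
  exact h1.hasDerivAt

/-- The coordinate velocity of a curve in the domain of the retraction is bounded by its speed, so
that the coordinate length is bounded by the Riemannian length. -/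
theorem IsLocalRetraction.integral_norm_le
    [RiemannianBundle (fun x : N => TangentSpace (𝓡 d) x)] {S : Set N} {ψ : E m → N} {U : Set (E m)}
    {q : N → E m} {O : Set N} (h : IsLocalRetraction d S ψ U q O) {γ : ℝ → N} {v : ℝ → E m}
    {C L : ℝ} (hC : 0 ≤ C) (hL : 0 ≤ L) (hv : Continuous v)
    (hγ : ∀ t ∈ Set.Ioo (0 : ℝ) 1, MDifferentiableAt 𝓘(ℝ, ℝ) (𝓡 d) γ t)
    (hO : ∀ t ∈ Set.Ioo (0 : ℝ) 1, γ t ∈ O)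
    (hv' : ∀ t ∈ Set.Ioo (0 : ℝ) 1, HasDerivAt (q ∘ γ) (v t) t)
    (hbound : ∀ t ∈ Set.Ioo (0 : ℝ) 1, ∀ w : TangentSpace (𝓡 d) (γ t),
      ‖vecDeriv d q (γ t) w‖ ≤ C * ‖w‖)
    (hlen : Manifold.pathELength (𝓡 d) γ 0 1 ≤ ENNReal.ofReal L) :
    ∫ t in (0 : ℝ)..1, ‖v t‖ ≤ C * L := by
  rw [← ENNReal.ofReal_le_ofReal_iff (by positivity),
    intervalIntegral.integral_of_le zero_le_one,
    MeasureTheory.ofReal_integral_norm_eq_lintegral_enorm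
      (intervalIntegrable_iff_integrableOn_Ioc_of_le zero_le_one |>.1
        (hv.intervalIntegrable _ _)),
    MeasureTheory.restrict_Ioc_eq_restrict_Icc, ← MeasureTheory.restrict_Ioo_eq_restrict_Icc,
    ENNReal.ofReal_mul hC]
  calc _ ≤ ∫⁻ t in Set.Ioo (0 : ℝ) 1,
          ENNReal.ofReal C * ‖mfderiv 𝓘(ℝ, ℝ) (𝓡 d) γ t (1 : ℝ)‖ₑ := by
        refine MeasureTheory.setLIntegral_mono' measurableSet_Ioo fun t ht => ?_
        rw [(hv' t ht).unique (h.hasDerivAt_comp (hγ t ht) (hO t ht)), ← ofReal_norm,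
          ← ofReal_norm, ← ENNReal.ofReal_mul hC]
        exact ENNReal.ofReal_le_ofReal (hbound t ht _)
    _ = ENNReal.ofReal C * Manifold.pathELength (𝓡 d) γ 0 1 := by
        rw [MeasureTheory.lintegral_const_mul' _ _ ENNReal.ofReal_ne_top,
          Manifold.pathELength_eq_lintegral_mfderiv_Ioo]
        rfl
    _ ≤ _ := by gcongr

variable [IsManifold (𝓡 d) ∞ N]

theorem IsLocalRetraction.continuousOn_vecDeriv {S : Set N} {ψ : E m → N} {U : Set (E m)}
    {q : N → E m} {O : Set N} (h : IsLocalRetraction d S ψ U q O) {γ : ℝ → N} {J : Set ℝ}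
    {V : ∀ t, TangentSpace (𝓡 d) (γ t)}
    (hV : ContinuousOn (fun t => (⟨γ t, V t⟩ : TangentBundle (𝓡 d) N)) J)
    (hγ : ∀ t ∈ J, γ t ∈ O) :
    ContinuousOn (fun t => vecDeriv d q (γ t) (V t)) J := by
  have h1 := h.smooth.continuousOn_tangentMapWithin le_rfl h.isOpen_domain.uniqueMDiffOn
  have h2 := (contMDiff_snd_tangentBundle_modelSpace (n := 0) (E m) (𝓡 m)).continuous
  refine (h2.comp_continuousOn (h1.comp hV fun t ht => hγ t ht)).congr fun t ht => ?_
  have h3 : mfderivWithin (𝓡 d) (𝓡 m) q O (γ t) = mfderiv (𝓡 d) (𝓡 m) q (γ t) :=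
    mfderivWithin_of_isOpen h.isOpen_domain (hγ t ht)
  exact (congrArg (fun T : E d →L[ℝ] E m => T (V t)) h3).symm

variable [RiemannianBundle (fun x : N => TangentSpace (𝓡 d) x)]

theorem contDiffAt_connForm_gram [IsContMDiffRiemannianBundle (𝓡 d) ∞ (E d)
    (fun x : N => TangentSpace (𝓡 d) x)] {S : Set N} {ψ : E m → N} {U : Set (E m)}
    (h : IsLocalParam d S ψ U) {u : E m} (hu : u ∈ U) :
    ContDiffAt ℝ ∞ (connForm (gram d ψ)) u :=
  contDiffAt_connForm fun k i j => contDiffAt_christoffel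
    (contDiffAt_gram h.isOpen h.smooth hu) (det_gram_ne_zero (h.immersion u hu)) k i j

namespace IsLocalRetraction

variable {S : Set N} {ψ : E m → N} {U : Set (E m)} {q : N → E m} {O : Set N}

variable [IsContMDiffRiemannianBundle (𝓡 d) ∞ (E d) (fun x : N => TangentSpace (𝓡 d) x)]
  [IsRiemannianManifold (𝓡 d) N]

/-- Parallel transport between nearby points `ψ w` and `ψ w'`, in the coordinates given by `ψ`,
is `id - Γ_w(w' - w, ·)` up to an error that is quadratic in `w' - w`. Minimality of the geodesic
is used only to bound its length by that of a coordinate segment. -/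
theorem exists_norm_parallelTransport_le (h : IsLocalRetraction d S ψ U q O) {U₀ : Set (E m)}
    (hψ : IsLocalParam d S ψ U₀) (hU : U ⊆ U₀) {u₀ : E m} (hu₀ : u₀ ∈ U) :
    ∃ C : ℝ, ∀ᶠ z in 𝓝 (u₀, u₀), ∀ (X : TangentSpace (𝓡 d) (ψ z.1))
      (Y : TangentSpace (𝓡 d) (ψ z.2)), ParallelTransport d m S (ψ z.1) (ψ z.2) X Y →
      ‖vecDeriv d q (ψ z.2) Y - vecDeriv d q (ψ z.1) X
        + connForm (gram d ψ) z.1 (z.2 - z.1) (vecDeriv d q (ψ z.1) X)‖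
        ≤ C * ‖vecDeriv d q (ψ z.1) X‖ * ‖z.2 - z.1‖ ^ 2 := by
  obtain ⟨K, hK, D, hD, hKb, hKl⟩ := exists_bound_and_lipschitz_of_contDiffAt
    ((contDiffAt_connForm_gram hψ (hU hu₀)).of_le (by simp))
  obtain ⟨C₁, hC₁, h₁⟩ := eventually_norm_mfderiv_param_le h.isOpen_source h.smooth_param hu₀
  have hx₀ := h.mem_domain u₀ hu₀
  obtain ⟨C₂, hC₂, h₂⟩ := eventually_norm_mfderiv_le (h.contMDiffAt hx₀)
  have hψc := (h.contMDiffAt_param hu₀).continuousAt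
  have hqc := (h.contMDiffAt hx₀).continuousAt
  -- a coordinate ball `ball u₀ r` on which all the bounds hold
  obtain ⟨r, hr, hball⟩ := Metric.eventually_nhds_iff_ball.1
    (((Filter.eventually_mem_set.2 hD).and
      (Filter.eventually_mem_set.2 (h.isOpen_source.mem_nhds hu₀))).and h₁)
  -- a metric ball of `N` around `ψ u₀` that meets `S` inside of the coordinate ball
  have hq₀ : ∀ᶠ y in 𝓝 (ψ u₀), q y ∈ Metric.ball u₀ r := by
    refine hqc.preimage_mem_nhds ?_
    rw [h.left_inv u₀ hu₀]
    exact Metric.ball_mem_nhds _ hr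
  obtain ⟨ε, hε, hεball⟩ := Metric.eventually_nhds_iff_ball.1
    ((h₂.and (Filter.eventually_mem_set.2 (h.isOpen_domain.mem_nhds hx₀))).and hq₀)
  refine ⟨2 * (K + K ^ 2) * (C₂ * C₁) ^ 2, ?_⟩
  have hfst : Filter.Tendsto (fun z : E m × E m => z.1) (𝓝 (u₀, u₀)) (𝓝 u₀) :=
    continuous_fst.continuousAt
  have hsnd : Filter.Tendsto (fun z : E m × E m => z.2) (𝓝 (u₀, u₀)) (𝓝 u₀) :=
    continuous_snd.continuousAt
  have hdiff : Filter.Tendsto (fun z : E m × E m => ‖z.2 - z.1‖) (𝓝 (u₀, u₀)) (𝓝 0) := by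
    simpa using (hsnd.sub hfst).norm
  have e1 : ∀ᶠ z in 𝓝 (u₀, u₀), C₁ * ‖z.2 - z.1‖ < ε / 2 := by
    refine (hdiff.const_mul C₁).eventually_lt_const ?_
    simpa using half_pos hε
  have e2 : ∀ᶠ z in 𝓝 (u₀, u₀), K * (C₂ * (C₁ * ‖z.2 - z.1‖)) < 1 / 2 := by
    refine (((hdiff.const_mul C₁).const_mul C₂).const_mul K).eventually_lt_const ?_
    norm_num
  have e3 : ∀ᶠ z in 𝓝 (u₀, u₀), dist (ψ z.1) (ψ u₀) < ε / 2 :=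
    hfst.eventually (hψc (Metric.ball_mem_nhds _ (half_pos hε)))
  filter_upwards [e1, e2, e3, hfst (Metric.ball_mem_nhds u₀ hr),
    hsnd (Metric.ball_mem_nhds u₀ hr)] with z hz1 hz2 hz3 hzw hzw' X Y hXY
  obtain ⟨w, w'⟩ := z
  dsimp only at *
  obtain ⟨γ, V, ⟨⟨hγ, hγS, -⟩, hγ0, hγ1, hγlen⟩, ⟨hVs, hVt, hVp⟩, hV0, hV1⟩ := hXY
  have hγ' : ContMDiffOn 𝓘(ℝ, ℝ) (𝓡 d) 1 γ (Set.Icc 0 1) := hγ.of_le (by simp)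
  have hlen : Manifold.pathELength (𝓡 d) γ 0 1 ≤ ENNReal.ofReal (C₁ * ‖w' - w‖) :=
    hγlen.trans_le (inducedEDist_param_le (convex_ball u₀ r)
      (fun u hu => h.mem u (hball u hu).1.2)
      (fun u hu => h.contMDiffAt_param (hball u hu).1.2) (fun u hu => (hball u hu).2) hzw hzw')
  have hγball : ∀ t ∈ Set.Icc (0 : ℝ) 1, γ t ∈ Metric.ball (ψ u₀) ε := by
    intro t ht
    have h3 : dist (γ 0) (γ t) ≤ C₁ * ‖w' - w‖ := by
      rw [← ENNReal.ofReal_le_ofReal_iff (by positivity), ← edist_dist]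
      exact (edist_le_pathELength hγ' ht).trans hlen
    rw [hγ0] at h3
    calc dist (γ t) (ψ u₀) ≤ dist (ψ w) (γ t) + dist (ψ w) (ψ u₀) := dist_triangle_left _ _ _
      _ < ε := by linarith
  have hγO : ∀ t ∈ Set.Icc (0 : ℝ) 1, γ t ∈ O := fun t ht => (hεball _ (hγball t ht)).1.2
  have hIcc : ∀ t ∈ Set.Ioo (0 : ℝ) 1, t ∈ Set.Icc (0 : ℝ) 1 := fun t ht => ⟨ht.1.le, ht.2.le⟩
  set u : ℝ → E m := q ∘ γ with hu
  set a : ℝ → E m := fun t => vecDeriv d q (γ t) (V t) with ha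
  have huC : ContDiffOn ℝ 1 u (Set.Icc 0 1) := contMDiffOn_iff_contDiffOn.1
    (h.smooth.comp hγ' hγO)
  have haC : ContinuousOn a (Set.Icc 0 1) := h.continuousOn_vecDeriv hVs.continuousOn hγO
  -- the velocity of `u`, continuously extended beyond the endpoints
  set v : ℝ → E m := Set.IccExtend zero_le_one
    ((Set.Icc (0 : ℝ) 1).domRestrict (derivWithin u (Set.Icc 0 1))) with hv
  have hvC : Continuous v := Continuous.Icc_extend' (continuousOn_iff_continuous_domRestrict.1
    (huC.continuousOn_derivWithin (uniqueDiffOn_Icc zero_lt_one) le_rfl))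
  have huv : ∀ t ∈ Set.Ioo (0 : ℝ) 1, HasDerivAt u (v t) t := by
    intro t ht
    have h3 : v t = derivWithin u (Set.Icc 0 1) t := Set.IccExtend_of_mem _ _ (hIcc t ht)
    rw [h3]
    exact ((huC.differentiableOn one_ne_zero) t (hIcc t ht)).hasDerivWithinAt.hasDerivAt
      (Icc_mem_nhds ht.1 ht.2)
  have hav : ∀ t ∈ Set.Ioo (0 : ℝ) 1,
      HasDerivAt a (-connForm (gram d ψ) (u t) (v t) (a t)) t := by
    intro t ht
    rw [connForm_apply, ← (huv t ht).deriv]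
    refine hVp ψ U₀ hψ t (by rwa [interior_Icc]) u a ?_
    filter_upwards [Ioo_mem_nhds ht.1 ht.2] with t' ht'
    have ht'' := hIcc t' ht'
    exact ⟨hU (h.mem_source _ (hγS ht'') (hγO t' ht'')),
      h.mk_mfderiv_param_mfderiv (hγS ht'') (hγO t' ht'') (hVt t' ht'')⟩
  have hL : ∫ t in (0 : ℝ)..1, ‖v t‖ ≤ C₂ * (C₁ * ‖w' - w‖) :=
    h.integral_norm_le hC₂ (by positivity) hvC
      (fun t ht => ((hγ' t (hIcc t ht)).contMDiffAt
        (Icc_mem_nhds ht.1 ht.2)).mdifferentiableAt one_ne_zero)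
      (fun t ht => hγO t (hIcc t ht)) huv
      (fun t ht => (hεball _ (hγball t (hIcc t ht))).1.1) hlen
  have key := norm_transport_le (D := Metric.ball u₀ r) hK (fun x hx => hKb x (hball x hx).1.1)
    (fun x hx y hy => hKl x (hball x hx).1.1 y (hball y hy).1.1) hvC huC.continuousOn haC huv hav
    (fun t ht => (hεball _ (hγball t ht)).2) hL hz2.le
  have ha0 : a 0 = vecDeriv d q (ψ w) X :=
    congrArg (fun p : TangentBundle (𝓡 d) N => vecDeriv d q p.1 p.2) hV0
  have ha1 : a 1 = vecDeriv d q (ψ w') Y :=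
    congrArg (fun p : TangentBundle (𝓡 d) N => vecDeriv d q p.1 p.2) hV1
  have hu0 : u 0 = w := by
    rw [hu, Function.comp_apply, hγ0, h.left_inv w (hball w hzw).1.2]
  have hu1 : u 1 = w' := by
    rw [hu, Function.comp_apply, hγ1, h.left_inv w' (hball w' hzw').1.2]
  rw [ha0, ha1, hu0, hu1] at key
  refine key.trans (le_of_eq ?_)
  ring

end IsLocalRetraction

variable [IsContMDiffRiemannianBundle (𝓡 d) ∞ (E d) (fun x : N => TangentSpace (𝓡 d) x)]

theorem IsLocalRetraction.eventually_mem_inducedBall {S : Set N} {ψ : E m → N} {U : Set (E m)}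
    {q : N → E m} {O : Set N} (h : IsLocalRetraction d S ψ U q O) {u₀ : E m} (hu₀ : u₀ ∈ U)
    {x₀ : N} {R : ℝ} (hx₀ : ψ u₀ ∈ inducedBall d S x₀ R) :
    ∀ᶠ w in 𝓝 u₀, ψ w ∈ inducedBall d S x₀ R := by
  obtain ⟨C, hC, hb⟩ := eventually_norm_mfderiv_param_le h.isOpen_source h.smooth_param hu₀
  obtain ⟨r, hr, hball⟩ := Metric.eventually_nhds_iff_ball.1
    ((Filter.eventually_mem_set.2 (h.isOpen_source.mem_nhds hu₀)).and hb)
  have hlim : Filter.Tendsto (fun w => inducedEDist d S x₀ (ψ u₀) + ENNReal.ofReal (C * ‖w - u₀‖))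
      (𝓝 u₀) (𝓝 (inducedEDist d S x₀ (ψ u₀))) := by
    have h1 : Filter.Tendsto (fun w => C * ‖w - u₀‖) (𝓝 u₀) (𝓝 0) := by
      have : Continuous fun w : E m => C * ‖w - u₀‖ := by fun_prop
      simpa using this.tendsto u₀
    have h2 := (ENNReal.tendsto_ofReal h1).const_add (inducedEDist d S x₀ (ψ u₀))
    simpa using h2
  filter_upwards [hlim.eventually_lt_const hx₀.2, Metric.ball_mem_nhds u₀ hr] with w hw hwr
  refine ⟨h.mem w (hball w hwr).1, lt_of_le_of_lt ?_ hw⟩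
  refine inducedEDist_triangle.trans (add_le_add_right ?_ _)
  exact inducedEDist_param_le (convex_ball u₀ r) (fun u hu => h.mem u (hball u hu).1)
    (fun u hu => h.contMDiffAt_param (hball u hu).1) (fun u hu => (hball u hu).2)
    (Metric.mem_ball_self hr) hwr

variable [IsRiemannianManifold (𝓡 d) N]

/-! ### Flatness -/

/-- If the parallel transport along minimizing geodesics between points of a ball is a cocycle,
then the ball is flat: transporting a vector from a fixed point gives a parallel vector field. -/
theorem isFlatOn_inducedBall_of_cocycle {S : Set N} {x₀ : N} {R : ℝ}
    (P : ∀ x y : N, TangentSpace (𝓡 d) x →ₗ[ℝ] TangentSpace (𝓡 d) y)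
    (hmaps : ∀ x ∈ S, ∀ y ∈ S, ∀ X ∈ tangentSub d S x, P x y X ∈ tangentSub d S y)
    (hrefl : ∀ x ∈ S, ∀ X ∈ tangentSub d S x, P x x X = X)
    (hcomp : ∀ x ∈ S, ∀ y ∈ S, ∀ z ∈ S, ∀ X ∈ tangentSub d S x, P x y X = P z y (P x z X))
    (hP : ∀ x ∈ inducedBall d S x₀ R, ∀ y ∈ inducedBall d S x₀ R, ∀ X ∈ tangentSub d S x,
      ParallelTransport d m S x y X (P x y X)) :
    IsFlatOn d m S (inducedBall d S x₀ R) := by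
  intro ψ U₀ hψ u₀ hu₀U₀ hu₀B l i j k
  obtain ⟨U, hU, q, O, hu₀, h⟩ := hψ.exists_isLocalRetraction hu₀U₀
  obtain ⟨C, hC⟩ := h.exists_norm_parallelTransport_le hψ hU hu₀
  set e : Fin m → E m := fun i => EuclideanSpace.single i 1 with he
  set X : TangentSpace (𝓡 d) (ψ u₀) := mfderiv (𝓡 m) (𝓡 d) ψ u₀ (e k)
  have hX : X ∈ tangentSub d S (ψ u₀) := h.mfderiv_param_mem_tangentSub hu₀ (e k)
  have hu₀S := h.mem u₀ hu₀
  -- the coordinates of the field obtained by transporting `X` from `ψ u₀`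
  set A : E m → E m := fun w => vecDeriv d q (ψ w) (P (ψ u₀) (ψ w) X) with hA
  have hA₀ : A u₀ = e k := by
    rw [hA]
    dsimp only
    rw [hrefl _ hu₀S X hX]
    exact h.mfderiv_mfderiv_param hu₀ (e k)
  have hgood : ∀ᶠ w in 𝓝 u₀, w ∈ U ∧ ψ w ∈ inducedBall d S x₀ R :=
    (Filter.eventually_mem_set.2 (h.isOpen_source.mem_nhds hu₀)).and
      (h.eventually_mem_inducedBall hu₀ hu₀B)
  have hnear : ∀ᶠ z in 𝓝 (u₀, u₀), ‖A z.2 - A z.1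
      + connForm (gram d ψ) z.1 (z.2 - z.1) (A z.1)‖ ≤ C * ‖A z.1‖ * ‖z.2 - z.1‖ ^ 2 := by
    filter_upwards [hC, continuous_fst.continuousAt.eventually hgood,
      continuous_snd.continuousAt.eventually hgood] with z hz hz1 hz2
    have hS1 := h.mem _ hz1.1
    have hS2 := h.mem _ hz2.1
    refine hz _ _ ?_
    rw [hcomp _ hu₀S _ hS2 _ hS1 X hX]
    exact hP _ hz1.2 _ hz2.2 _ (hmaps _ hu₀S _ hS1 X hX)
  have hderiv : ∀ᶠ w in 𝓝 u₀, HasFDerivAt A (-(connForm (gram d ψ) w).flip (A w)) w := by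
    have hdiag : Filter.Tendsto (fun w : E m => (w, w)) (𝓝 u₀) (𝓝 (u₀, u₀)) :=
      (continuous_id.prodMk continuous_id).continuousAt
    filter_upwards [hdiag.eventually (eventually_eventually_nhds.2 hnear)] with w hw
    exact hasFDerivAt_of_norm_sub_le_sq (C := C * ‖A w‖)
      ((Continuous.prodMk_right w).continuousAt.eventually hw)
  have hB : DifferentiableAt ℝ (connForm (gram d ψ)) u₀ :=
    (contDiffAt_connForm_gram hψ hu₀U₀).differentiableAt (by simp)
  have hcurv := curvature_apply_eq_zero hderiv hB (e i) (e j)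
  rw [hA₀] at hcurv
  rw [riemann_eq_connForm hB l i j k, hcurv]
  rfl

end Transport

end Horo

theorem mainTheorem10 {n : ℕ}
    {M : Type*} [TopologicalSpace M] [T2Space M] [CompactSpace M] [ConnectedSpace M]
    [ChartedSpace (Horo.E (n + 1)) M] [IsManifold (𝓡 (n + 1)) ∞ M]
    [RiemannianBundle (fun x : M => TangentSpace (𝓡 (n + 1)) x)]
    [IsContMDiffRiemannianBundle (𝓡 (n + 1)) ∞ (Horo.E (n + 1))
      (fun x : M => TangentSpace (𝓡 (n + 1)) x)]
    {N : Type*} [MetricSpace N]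
    [ChartedSpace (Horo.E (n + 1)) N] [IsManifold (𝓡 (n + 1)) ∞ N]
    [RiemannianBundle (fun x : N => TangentSpace (𝓡 (n + 1)) x)]
    [IsContMDiffRiemannianBundle (𝓡 (n + 1)) ∞ (Horo.E (n + 1))
      (fun x : N => TangentSpace (𝓡 (n + 1)) x)]
    [IsRiemannianManifold (𝓡 (n + 1)) N]
    (τ : ℝ) (hτ0 : 0 < τ) (hτ1 : τ < 1)
    (hκ : Horo.SectionalCurvatureBetween (n + 1) M (-4 * (1 - τ)) (-1))
    (p : N → M) (hp : Horo.IsRiemannianUniversalCover (n + 1) p)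
    (ρ : ℝ) (hρ : 0 < ρ)
    (hinj : ∀ c : ℝ → N, Horo.IsUnitSpeedGeodesic (n + 1) c → ∀ s : ℝ,
      Horo.UniqueMinGeodesics (n + 1) n (Horo.horosphere c s) ρ)
    (c : ℝ → N) (hc : Horo.IsUnitSpeedGeodesic (n + 1) c)
    (Φ : ℝ → ∀ x y : N, TangentSpace (𝓡 (n + 1)) x →ₗ[ℝ] TangentSpace (𝓡 (n + 1)) y)
    (hΦ : Horo.IsStableHolonomy (n + 1) n c ρ Φ)
    (s : ℝ) (x₀ : N) (hx₀ : x₀ ∈ Horo.horosphere c s)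
    (hcoincide : ∀ x ∈ Horo.inducedBall (n + 1) (Horo.horosphere c s) x₀ (ρ / 2),
      ∀ y ∈ Horo.inducedBall (n + 1) (Horo.horosphere c s) x₀ (ρ / 2),
      ∀ X ∈ Horo.tangentSub (n + 1) (Horo.horosphere c s) x,
        Horo.ParallelTransport (n + 1) n (Horo.horosphere c s) x y X (Φ s x y X)) :
    Horo.IsFlatOn (n + 1) n (Horo.horosphere c s)
      (Horo.inducedBall (n + 1) (Horo.horosphere c s) x₀ (ρ / 2)) :=
  Horo.isFlatOn_inducedBall_of_cocycle (Φ s) (hΦ.mapsTo s) (hΦ.refl s) (hΦ.comp s) hcoincide
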